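/- Let $A=(a_{ij})$ be a real $n\times m$ matrix with row set $X=\{1,\dots,n\}$ and column set $Y=\{1,\dots,m\}$, let $\epsilon\ge 0$ and $1\le minRow\le n$. For $I\subseteq X$, $I\ne\emptyset$, and $j\in Y$ put $\rho_j(I)=\max_{i\in I}a_{ij}-\min_{i\in I}a_{ij}$. A pair $(I,J)$, $I\subseteq X$, $J\subseteq Y$, is a *CVC bicluster* (with perturbation at most $\epsilon$) if $\rho_j(I)\le\epsilon$ for all $j\in J$; it is *maximal* if moreover neither $(I\cup\{x\},J)$ for any $x\in X\setminus I$ nor $(I,J\cup\{y\})$ for any $y\in Y\setminus J$ is a CVC bicluster. The algorithm RIn-Close_CVC calls $\mathrm{Compute}((X,\emptyset),1,\emptyset)$ with an empty symbol table $ST$, where $\mathrm{Compute}((I,J),y,\Gamma)$ does the following. For $j=y,\dots,m$ with $j\notin J$: if $\rho_j(I)\le\epsilon$, add $j$ to $J$; otherwise sort $I$ by the values in column $j$ and scan it for the inclusion-maximal subsets $G\subseteq I$ with $\rho_j(G)\le\epsilon$, and for each such $G$ with (i) $|G|\ge minRow$, (ii) $G\notin ST$, (iii) $\rho_k(G)>\epsilon$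 for every $k<j$, $k\notin J$, and (iv) $(G\cup\{g\},J\cup\{j\})$ not a CVC bicluster for any $g\in\Gamma$, insert $G$ (as an ascending list of rows) into $ST$ and put $(G,j,\Omega)$ in a queue, where $$\Omega=\Gamma\cup\{i\in I\setminus G : p_1-a_{ij}\le\epsilon\ \text{or}\ a_{ij}-p_2\le\epsilon\}$$ and $p_1,p_2$ are the $minRow$-th smallest and the $minRow$-th largest of the values $a_{ij}$, $i\in G$. Then output $(I,J)$, and for each $(G,j,\Omega)$ in the queue, in order, call $\mathrm{Compute}((G,J\cup\{j\}),j+1,\Omega)$. All that follows also holds for the variant in which "or" in the definition of $\Omega$ is replaced by "and". The symbol table is a balanced (size-balanced) binary search tree, or a hash table with $b$ chained buckets and an arbitrary hash function. Steps are counted on a real-number RAM: comparisons of two entries of $A$ or of two row indices, real arithmetic on a bounded number of entries, and accesses to one memory cell take bounded time, and evaluating the hash function takes time proportional to the length of the key. **Proposition.** With either kind of symbol table, RIn-Close_CVC is 1. *complete*: every maximal CVC bicluster with at least $minRow$ rows is output (so for $minRow=1$ every maximal CVC bicluster is); 2. *correct*: every output is a CVC bicluster with perturbation at most $\epsilon$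 and at least $minRow$ rows; 3. *non-redundant*: every output is a maximal CVC bicluster, and no bicluster is output twice; 4. *efficient*: let $m\ge1$ and let $q$ be the number of outputs. There is an absolute constant $C$ such that, with the search tree, the time before the first output, between two consecutive outputs, and from the last output to termination is each at most $C\,n^2m(n+m)$, and the total running time is at most $C\,q\,n\,m\,(n\lfloor\log_2 n\rfloor+nm+x)$ with $x=n\lfloor\log_2 q\rfloor$; with the hash table the total running time is at most $C\,(b+q\,n\,m\,(n\lfloor\log_2 n\rfloor+nm+x))$ with $x=nL$ whenever no bucket holds more than $L$ keys at the end, and in particular (worst case) with $x=nq$. -/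

import Mathlib

namespace RInClose

/-! ### Biclusters -/

/-- A pair `(I, J)` of a row-set and a column-set of an `n × m` matrix. -/
abbrev Bicluster (n m : ℕ) : Type := Finset (Fin n) × Finset (Fin m)

/-- `max_{i ∈ I} a_{ij} - min_{i ∈ I} a_{ij}`, and `0` for the empty row-set. -/
noncomputable def spread {n m : ℕ} (A : Matrix (Fin n) (Fin m) ℝ) (I : Finset (Fin n))
    (j : Fin m) : ℝ :=
  if h : I.Nonempty then I.sup' h (fun i => A i j) - I.inf' h (fun i => A i j) else 0

/-- Bicluster with constant values on columns, up to a perturbation `ε`. -/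
def IsCVC {n m : ℕ} (A : Matrix (Fin n) (Fin m) ℝ) (ε : ℝ) (B : Bicluster n m) : Prop :=
  ∀ j ∈ B.2, spread A B.1 j ≤ ε

/-- A CVC bicluster to which neither a row nor a column can be added. -/
def IsMaximalCVC {n m : ℕ} (A : Matrix (Fin n) (Fin m) ℝ) (ε : ℝ) (B : Bicluster n m) : Prop :=
  IsCVC A ε B ∧ (∀ x, x ∉ B.1 → ¬ IsCVC A ε (insert x B.1, B.2)) ∧
    ∀ y, y ∉ B.2 → ¬ IsCVC A ε (B.1, insert y B.2)

/-- Every maximal CVC bicluster with at least `minRow` rows is listed. -/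
def Complete {n m : ℕ} (A : Matrix (Fin n) (Fin m) ℝ) (ε : ℝ) (minRow : ℕ)
    (out : List (Bicluster n m)) : Prop :=
  ∀ B : Bicluster n m, IsMaximalCVC A ε B → minRow ≤ B.1.card → B ∈ out

/-- Every listed pair is a CVC bicluster with perturbation at most `ε` and has at least `minRow`
rows. -/
def Correct {n m : ℕ} (A : Matrix (Fin n) (Fin m) ℝ) (ε : ℝ) (minRow : ℕ)
    (out : List (Bicluster n m)) : Prop :=
  ∀ B ∈ out, IsCVC A ε B ∧ minRow ≤ B.1.card

/-- Only maximal biclusters are listed, each of them once. -/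
def NonRedundant {n m : ℕ} (A : Matrix (Fin n) (Fin m) ℝ) (ε : ℝ)
    (out : List (Bicluster n m)) : Prop :=
  (∀ B ∈ out, IsMaximalCVC A ε B) ∧ out.Nodup

/-! ### Step counting

Cost model: a real-number RAM. Comparing two matrix entries or two row indices, real arithmetic on
a bounded number of entries, reading or writing one cell of an array or of a list, and following
one pointer cost a bounded number of steps. -/

/-- The result of a computation together with the number of steps it took. -/
structure Timed (α : Type) where
  val : α
  time : ℕ

instance : Monad Timed where
  pure a := ⟨a, 0⟩
  bind x f := ⟨(f x.val).val, x.time + (f x.val).time⟩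

/-- Spend `k` steps. -/
def charge (k : ℕ) : Timed Unit := ⟨(), k⟩

/-- Spend one step. -/
def tick : Timed Unit := charge 1

/-- Merging two lists that are sorted by the value `v`. -/
noncomputable def merge {α : Type} (v : α → ℝ) : List α → List α → Timed (List α)
  | [], l => pure l
  | l, [] => pure l
  | a :: l, b :: r => do
      tick
      if v a ≤ v b then do
        let t ← merge v l (b :: r)
        pure (a :: t)
      else do
        let t ← merge v (a :: l) r
        pure (b :: t)

/-- Merge sort by the value `v`. -/
noncomputable def mergeSort {α : Type} (v : α → ℝ) : List α → Timed (List α)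
  | [] => pure []
  | [a] => pure [a]
  | a :: b :: l => do
      charge (l.length + 2)
      let s ← mergeSort v ((a :: b :: l).take ((l.length + 2) / 2))
      let t ← mergeSort v ((a :: b :: l).drop ((l.length + 2) / 2))
      merge v s t
termination_by l => l.length
decreasing_by
  · simp only [List.length_take, List.length_cons]; omega
  · simp only [List.length_drop, List.length_cons]; omega

/-- The largest and the smallest value of `v` on a non-empty list. -/
noncomputable def extrema {α : Type} (v : α → ℝ) : List α → Timed (ℝ × ℝ)
  | [] => pure (0, 0)
  | [i] => do
      tick
      pure (v i, v i)
  | i :: i' :: l => do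
      tick
      let e ← extrema v (i' :: l)
      pure (max (v i) e.1, min (v i) e.2)

/-! ### Symbol tables -/

/-- The operations of a symbol table with keys in `κ` and states in `σ`. -/
structure SymbolTable (κ σ : Type) where
  empty : Timed σ
  search : κ → σ → Timed Bool
  insert : κ → σ → Timed σ

/-- Lexicographic comparison of two keys, entry by entry. -/
def keyCmp {n : ℕ} : List (Fin n) → List (Fin n) → Timed Ordering
  | [], [] => do
      tick
      pure .eq
  | [], _ :: _ => do
      tick
      pure .lt
  | _ :: _, [] => do
      tick
      pure .gt
  | a :: k, b :: l => do
      tick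
      if a < b then pure .lt else if b < a then pure .gt else keyCmp k l

/-- Search in a size-balanced binary search tree. -/
def treeSearch {n : ℕ} (k : List (Fin n)) : Ordnode (List (Fin n)) → Timed Bool
  | .nil => do
      tick
      pure false
  | .node _ l x r => do
      tick
      let c ← keyCmp k x
      match c with
      | .lt => treeSearch k l
      | .eq => pure true
      | .gt => treeSearch k r

/-- Insertion in a size-balanced binary search tree; one rebalancing step takes bounded time. -/
def treeInsert {n : ℕ} (k : List (Fin n)) :
    Ordnode (List (Fin n)) → Timed (Ordnode (List (Fin n)))
  | .nil => do
      tick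
      pure (Ordnode.singleton k)
  | .node s l x r => do
      tick
      let c ← keyCmp k x
      match c with
      | .lt => do
          let l' ← treeInsert k l
          pure (Ordnode.balanceL l' x r)
      | .eq => pure (.node s l k r)
      | .gt => do
          let r' ← treeInsert k r
          pure (Ordnode.balanceR l x r')

/-- The symbol table as a balanced search tree. -/
def searchTree (n : ℕ) : SymbolTable (List (Fin n)) (Ordnode (List (Fin n))) where
  empty := pure .nil
  search := treeSearch
  insert := treeInsert

/-- Sequential search in a chain of keys. -/
def chainSearch {n : ℕ} (k : List (Fin n)) : List (List (Fin n)) → Timed Bool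
  | [] => do
      tick
      pure false
  | x :: l => do
      tick
      let c ← keyCmp k x
      match c with
      | .eq => pure true
      | _ => chainSearch k l

/-- The symbol table as a hash table with `b` chained buckets and hash function `hash`. Creating
the table takes `b` steps, evaluating the hash function at a key one step per entry. -/
def hashTable {n b : ℕ} (hash : List (Fin n) → Fin b) :
    SymbolTable (List (Fin n)) (Fin b → List (List (Fin n))) where
  empty := ⟨fun _ => [], b⟩
  search k t := do
    charge (k.length + 1)
    chainSearch k (t (hash k))
  insert k t := do
    charge (k.length + 2)
    pure (Function.update t (hash k) (k :: t (hash k)))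

/-! ### The algorithm

Row-sets are lists of rows, column-sets are kept as bit arrays of length `m` (one step for a
membership test or an insertion, `m` steps for a copy). -/

/-- How the two pivot inequalities `p₁ - a_{ij} ≤ ε` and `a_{ij} - p₂ ≤ ε` are combined. -/
inductive PivotRule
  | either
  | both

/-- The combined pivot condition. -/
def PivotRule.Holds : PivotRule → Prop → Prop → Prop
  | .either, P, Q => P ∨ Q
  | .both, P, Q => P ∧ Q

/-- The data matrix and the user-defined parameters. -/
structure Input (n m : ℕ) where
  A : Matrix (Fin n) (Fin m) ℝ
  ε : ℝ
  minRow : ℕ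
  rule : PivotRule

/-- A queued descendant: its row-set (in ascending order), the attribute where it was created and
its set of rows to check the row-maximality of its descendants. -/
structure Entry (n m : ℕ) where
  rows : List (Fin n)
  col : Fin m
  check : List (Fin n)

section Algorithm

variable {n m : ℕ} (P : Input n m)

/-- The longest prefix of the list with values in column `j` at most `x + ε`. -/
noncomputable def takeWithin (j : Fin m) (x : ℝ) : List (Fin n) → Timed (List (Fin n))
  | [] => pure []
  | i :: l => do
      tick
      if P.A i j - x ≤ P.ε then do
        let t ← takeWithin j x l
        pure (i :: t)
      else pure []

/-- Scrolling through a row list that is sorted by column `j`: the possible new row-sets are the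
longest runs with perturbation at most `ε`, without those contained in the preceding run, whose
length is `prev`. -/
noncomputable def newRowSets (j : Fin m) : ℕ → List (Fin n) → Timed (List (List (Fin n)))
  | _, [] => pure []
  | prev, i :: l => do
      let w ← takeWithin P j (P.A i j) (i :: l)
      charge (w.length + 1)
      let ws ← newRowSets j w.length l
      pure (if prev ≤ w.length then w :: ws else ws)

/-- Canonicity of `G`: none of the listed columns that are outside `J` can be added. -/
noncomputable def isCanonical (G : List (Fin n)) (J : Finset (Fin m)) :
    List (Fin m) → Timed Bool
  | [] => pure true
  | k :: ks => do
      tick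
      if k ∈ J then isCanonical G J ks
      else do
        let e ← extrema (fun i => P.A i k) G
        if e.1 - e.2 ≤ P.ε then pure false else isCanonical G J ks

/-- The listed columns that belong to `H`, each with the extrema of the rows `G` in it. -/
noncomputable def columnBounds (G : List (Fin n)) (H : Finset (Fin m)) :
    List (Fin m) → Timed (List (Fin m × ℝ × ℝ))
  | [] => pure []
  | k :: ks => do
      tick
      if k ∈ H then do
        let e ← extrema (fun i => P.A i k) G
        let t ← columnBounds G H ks
        pure ((k, e) :: t)
      else columnBounds G H ks

/-- Whether the row `g` can be added, given the extrema of the columns. -/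
noncomputable def rowFits (g : Fin n) : List (Fin m × ℝ × ℝ) → Timed Bool
  | [] => pure true
  | e :: es => do
      tick
      if max (P.A g e.1) e.2.1 - min (P.A g e.1) e.2.2 ≤ P.ε then rowFits g es else pure false

/-- Whether none of the listed rows can be added, given the extrema of the columns. -/
noncomputable def noRowFits (es : List (Fin m × ℝ × ℝ)) : List (Fin n) → Timed Bool
  | [] => pure true
  | g :: gs => do
      tick
      let b ← rowFits P g es
      if b then pure false else noRowFits es gs

/-- Row-maximality of `(G, H)`, checked against the rows in `Γ` only. -/
noncomputable def isRowMaximal (G : List (Fin n)) (H : Finset (Fin m)) (Γ : List (Fin n)) :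
    Timed Bool := do
  let es ← columnBounds P G H (List.finRange m)
  noRowFits P es Γ

open Classical in
/-- `ComputeRM(G, j, Γ, I)`, where `w` lists `G` in increasing order of the values in column `j`,
so that the pivots are the `minRow`-th entries from its two ends. Membership in `G` is read off a
bit array of length `n`. -/
noncomputable def computeRM (w : List (Fin n)) (j : Fin m) (Γ I : List (Fin n)) :
    Timed (List (Fin n)) := do
  charge (n + 3 * w.length + I.length + Γ.length)
  let p₁ := (w.map fun i => P.A i j).getD (P.minRow - 1) 0
  let p₂ := (w.map fun i => P.A i j).reverse.getD (P.minRow - 1) 0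
  pure (Γ ++ I.filter fun i =>
    decide (i ∉ w ∧ P.rule.Holds (p₁ - P.A i j ≤ P.ε) (P.A i j - p₂ ≤ P.ε)))

/-- The rows `w` in ascending order, extracted from the ascending list `I` by means of a bit array
of length `n`. -/
def ascending (w I : List (Fin n)) : Timed (List (Fin n)) := do
  charge (n + w.length + I.length)
  pure (I.filter fun i => decide (i ∈ w))

variable {σ : Type} (S : SymbolTable (List (Fin n)) σ)

/-- Treatment of one possible new row-set `w`, found in column `j` while `(I, J)` is closed: the
descendant to be queued, if any, and the new symbol table. -/
noncomputable def candidate (I Γ : List (Fin n)) (J : Finset (Fin m)) (j : Fin m)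
    (w : List (Fin n)) (t : σ) : Timed (Option (Entry n m) × σ) := do
  charge (w.length + 1)
  if w.length < P.minRow then pure (none, t)
  else do
    let G ← ascending w I
    let found ← S.search G t
    if found then pure (none, t)
    else do
      let can ← isCanonical P G J ((List.finRange m).take j)
      if !can then pure (none, t)
      else do
        charge m
        let rmax ← isRowMaximal P G (insert j J) Γ
        if !rmax then pure (none, t)
        else do
          let t' ← S.insert G t
          let Ω ← computeRM P w j Γ I
          tick
          pure (some ⟨G, j, Ω⟩, t')

/-- The loop over the possible new row-sets. -/
noncomputable def candidates (I Γ : List (Fin n)) (J : Finset (Fin m)) (j : Fin m) :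
    List (List (Fin n)) → σ → Timed (List (Entry n m) × σ)
  | [], t => pure ([], t)
  | w :: ws, t => do
      let r ← candidate P S I Γ J j w t
      let s ← candidates I Γ J j ws r.2
      pure (r.1.toList ++ s.1, s.2)

/-- The loop over the attributes: the closed column-set, the queue and the symbol table. -/
noncomputable def closeColumns (I Γ : List (Fin n)) :
    List (Fin m) → Finset (Fin m) → σ → Timed (Finset (Fin m) × List (Entry n m) × σ)
  | [], J, t => pure (J, [], t)
  | j :: js, J, t => do
      tick
      if j ∈ J then closeColumns I Γ js J t
      else do
        let e ← extrema (fun i => P.A i j) I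
        if e.1 - e.2 ≤ P.ε then do
          tick
          closeColumns I Γ js (insert j J) t
        else do
          let L ← mergeSort (fun i => P.A i j) I
          let ws ← newRowSets P j 0 L
          let r ← candidates P S I Γ J j ws t
          let s ← closeColumns I Γ js J r.2
          pure (s.1, r.1 ++ s.2.1, s.2.2)

end Algorithm

/-- The state of a run: the number of steps so far, the symbol table, and the biclusters
enumerated so far, in this order, each with the time at which it was completely written. -/
structure Run (n m : ℕ) (σ : Type) where
  clock : ℕ
  table : σ
  out : List (ℕ × Bicluster n m)

/-- The state after spending `k` steps. -/
def Run.wait {n m : ℕ} {σ : Type} (s : Run n m σ) (k : ℕ) : Run n m σ :=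
  { s with clock := s.clock + k }

/-- The enumerated biclusters. -/
def Run.biclusters {n m : ℕ} {σ : Type} (s : Run n m σ) : List (Bicluster n m) :=
  s.out.map Prod.snd

/-- `ComputeBiclustersFrom((I, J), y, Γ)`, with attributes numbered from `0`. Once its attributes
have been looped over, the bicluster is written in `|I| + m` steps; then the queue is emptied, each
descendant inheriting a copy of the column-set. All queued attributes are at least `y`, so that
the test `y ≤ e.col` always succeeds; it only makes the termination of the recursion evident. -/
noncomputable def computeBiclustersFrom {n m : ℕ} {σ : Type} (P : Input n m)
    (S : SymbolTable (List (Fin n)) σ) (I : List (Fin n)) (J : Finset (Fin m)) (y : ℕ)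
    (Γ : List (Fin n)) (s : Run n m σ) : Run n m σ :=
  let c := closeColumns P S I Γ ((List.finRange m).drop y) J s.table
  let J' := c.val.1
  let t := s.clock + c.time + (I.length + m)
  let s' : Run n m σ := ⟨t, c.val.2.2, s.out ++ [(t, I.toFinset, J')]⟩
  (c.val.2.1.foldl (fun s e =>
    if _h : y ≤ e.col then
      computeBiclustersFrom P S e.rows (insert e.col J') (e.col + 1) e.check (s.wait (m + 1))
    else s) s').wait 1
termination_by m - y
decreasing_by have := e.col.isLt; omega

/-- The algorithm `RIn-Close_CVC`: the call on `(X, ∅)`, the first attribute and `Γ = ∅`, with an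
empty symbol table. -/
noncomputable def rinCloseCVC {n m : ℕ} {σ : Type} (P : Input n m)
    (S : SymbolTable (List (Fin n)) σ) : Run n m σ :=
  computeBiclustersFrom P S (List.finRange n) ∅ 0 []
    ⟨n + m + S.empty.time, S.empty.val, []⟩

end RInClose

/-! By `isMaximalCVC_iff` a maximal bicluster is determined by its row-set `I`: its columns are
those on which `I` has perturbation at most `ε` (`closedCols`), and no row fits `I` on all of them
(`RowMaximal`). The algorithm is thus a search among row-sets, started at `X`.

Completeness (`mem_of_expanded`) is an induction on the number of columns needed for row-maximality.
Let `M` be row-maximal for its closed columns up to `k`. If `k` is not closed for `M`, the smaller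
columns suffice. Otherwise enlarge `M` to an inclusion-maximal `I` on which the closed columns of
`M` below `k` stay closed. By induction `I` is found, and either `I = M` or `M` is an
inclusion-maximal run of `I` in column `k` passing every test. The call on `I` starts no later than
column `k` (`Frame.least`), so it meets `M`. Closeness up to `ε` is not transitive, so `I` is not
unique and `M` may be met from several calls; the symbol table keeps one copy.

For correctness, a new run `G` of `I` in column `j` must be row-maximal. Rows of `I` outside `G` are
excluded by column `j`. For the other rows, testing those of `Γ` suffices by `Frame.cover`: every
row outside `I` that fits some large enough subset of `I` on the closed columns treated so far is in
`Γ`. `Frame.child` restores this invariant through `pivot_le`: a row that fits `minRow` rows of `G`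
in column `j` satisfies both pivot inequalities, so "or" and "and" are equally sound.

For the running time, maximality is tested before queuing, so every call outputs exactly one new
bicluster. Its work is at most `nodeCost`, where the cost of a table operation is that of the final
table, since tables only grow. Starting columns increase strictly along nested calls, so unwinding
the recursion adds only `O(m)` idle steps between outputs. Row-sets are distinct, so `q ≤ 2 ^ n`,
and a search tree operation takes `O(n ^ 2)` steps. -/

namespace RInClose

/-! ### Values and times of step-counted computations -/

namespace Timed

variable {α β : Type}

@[simp] theorem val_pure (a : α) : (pure a : Timed α).val = a := rfl

@[simp] theorem time_pure (a : α) : (pure a : Timed α).time = 0 := rfl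

@[simp] theorem val_bind (x : Timed α) (f : α → Timed β) : (x >>= f).val = (f x.val).val := rfl

@[simp] theorem time_bind (x : Timed α) (f : α → Timed β) :
    (x >>= f).time = x.time + (f x.val).time := rfl

@[simp] theorem time_tick : tick.time = 1 := rfl

@[simp] theorem time_charge (k : ℕ) : (charge k).time = k := rfl

@[simp] theorem val_ite (c : Prop) [Decidable c] (x y : Timed α) :
    (if c then x else y).val = if c then x.val else y.val := by split_ifs <;> rfl

@[simp] theorem time_ite (c : Prop) [Decidable c] (x y : Timed α) :
    (if c then x else y).time = if c then x.time else y.time := by split_ifs <;> rfl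

end Timed

/-! ### Specification of symbol tables -/

/-- A correct implementation of a symbol table for keys of length at most `n`: `Rep t K` says that
the state `t` holds the set of keys `K`; `cost t` bounds the time of one operation on `t`. -/
structure TableSpec {n : ℕ} {σ : Type} (S : SymbolTable (List (Fin n)) σ) where
  Rep : σ → Finset (List (Fin n)) → Prop
  cost : σ → ℕ
  rep_empty : Rep S.empty.val ∅
  search_val : ∀ {t K}, Rep t K → ∀ k, (S.search k t).val = true ↔ k ∈ K
  rep_insert : ∀ {t K}, Rep t K → ∀ k, k ∉ K → Rep (S.insert k t).val (insert k K)
  search_time : ∀ {t K}, Rep t K → ∀ k, k.length ≤ n → (S.search k t).time ≤ cost t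
  insert_time : ∀ {t K}, Rep t K → ∀ k, k.length ≤ n → (S.insert k t).time ≤ cost t
  cost_mono : ∀ {t K}, Rep t K → ∀ k, k ∉ K → cost t ≤ cost (S.insert k t).val

/-! ### Comparison of keys -/

theorem keyCmp_time {n : ℕ} : ∀ k l : List (Fin n), (keyCmp k l).time ≤ k.length + 1
  | [], [] => by simp [keyCmp]
  | [], _ :: _ => by simp [keyCmp]
  | _ :: _, [] => by simp [keyCmp]
  | a :: k, b :: l => by
      have := keyCmp_time k l
      simp only [keyCmp, Timed.time_bind, Timed.time_tick, Timed.time_ite, Timed.time_pure,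
        List.length_cons]
      split_ifs <;> omega

/-- Identifies the step-counted comparison with the linear order on lists, so that the theory of
ordered trees in `Ordnode` applies. -/
theorem keyCmp_val {n : ℕ} : ∀ k l : List (Fin n), (keyCmp k l).val = cmpLE k l
  | [], [] => by simp [keyCmp, cmpLE]
  | [], b :: l => by
      have h : ([] : List (Fin n)) < b :: l := List.nil_lt_cons b l
      simp [keyCmp, cmpLE, h.le, not_le.2 h]
  | a :: k, [] => by
      have h : ([] : List (Fin n)) < a :: k := List.nil_lt_cons a k
      simp [keyCmp, cmpLE, not_le.2 h]
  | a :: k, b :: l => by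
      have ih := keyCmp_val k l
      simp only [keyCmp, Timed.val_bind, Timed.val_ite, Timed.val_pure]
      split_ifs with h₁ h₂
      · have h : a :: k < b :: l := List.cons_lt_cons_iff.2 (Or.inl h₁)
        simp [cmpLE, h.le, not_le.2 h]
      · have h : b :: l < a :: k := List.cons_lt_cons_iff.2 (Or.inl h₂)
        simp [cmpLE, not_le.2 h]
      · obtain rfl : a = b := le_antisymm (not_lt.1 h₂) (not_lt.1 h₁)
        have e : ∀ x y : List (Fin n), a :: x ≤ a :: y ↔ x ≤ y := fun x y => by
          rw [← not_lt, ← not_lt, List.cons_lt_cons_iff]; simp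
        rw [ih]
        simp [cmpLE, e]

/-! ### The search tree -/

/-- The number of nodes on a longest path from the root. -/
def treeDepth {α : Type} : Ordnode α → ℕ
  | .nil => 0
  | .node _ l _ r => max (treeDepth l) (treeDepth r) + 1

/-- Balance factor 3 gives each subtree a value of size plus one at most 3/4 of that of the whole
tree, and `(4/3) ^ 3 > 2`; hence the exponent 3. -/
theorem two_pow_treeDepth_le {α : Type} :
    ∀ t : Ordnode α, t.Sized → t.Balanced → 2 ^ treeDepth t ≤ (t.size + 1) ^ 3
  | .nil, _, _ => by simp [treeDepth]
  | .node s l x r, hs, hb => by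
      have il := two_pow_treeDepth_le l hs.2.1 hb.2.1
      have ir := two_pow_treeDepth_le r hs.2.2 hb.2.2
      have hsz : s = l.size + r.size + 1 := hs.1
      have key : ∀ a b : ℕ, 4 * (a + 1) ≤ 3 * (b + 1) → 2 * (a + 1) ^ 3 ≤ (b + 1) ^ 3 := by
        intro a b h
        have := Nat.pow_le_pow_left h 3
        rw [mul_pow, mul_pow] at this
        omega
      have hbal := hb.1
      simp only [Ordnode.BalancedSz, Ordnode.delta] at hbal
      have kl := key l.size s (by omega)
      have kr := key r.size s (by omega)
      change 2 ^ (max (treeDepth l) (treeDepth r) + 1) ≤ (s + 1) ^ 3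
      rw [pow_succ]
      rcases max_choice (treeDepth l) (treeDepth r) with h | h <;> rw [h] <;> omega

theorem treeDepth_le {α : Type} (t : Ordnode α) (hs : t.Sized) (hb : t.Balanced) :
    treeDepth t ≤ 3 * Nat.log 2 (t.size + 1) + 3 := by
  have h₁ := two_pow_treeDepth_le t hs hb
  have h₂ : t.size + 1 < 2 ^ (Nat.log 2 (t.size + 1) + 1) := Nat.lt_pow_succ_log_self one_lt_two _
  have h₃ := h₁.trans (Nat.pow_le_pow_left h₂.le 3)
  rw [← pow_mul] at h₃
  have := (Nat.pow_le_pow_iff_right one_lt_two).1 h₃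
  omega

theorem treeSearch_time {n : ℕ} (k : List (Fin n)) :
    ∀ t, (treeSearch k t).time ≤ treeDepth t * (k.length + 2) + 1
  | .nil => by simp [treeSearch, treeDepth]
  | .node _ l x r => by
      have il := treeSearch_time k l
      have ir := treeSearch_time k r
      have hc := keyCmp_time k x
      have hl := Nat.mul_le_mul_right (k.length + 2) (le_max_left (treeDepth l) (treeDepth r))
      have hr := Nat.mul_le_mul_right (k.length + 2) (le_max_right (treeDepth l) (treeDepth r))
      simp only [treeSearch, Timed.time_bind, Timed.time_tick, treeDepth, add_mul, one_mul]
      rcases (keyCmp k x).val with _ | _ | _ <;> simp only [Timed.time_pure] <;> omega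

theorem treeInsert_time {n : ℕ} (k : List (Fin n)) :
    ∀ t, (treeInsert k t).time ≤ treeDepth t * (k.length + 2) + 1
  | .nil => by simp [treeInsert, treeDepth]
  | .node _ l x r => by
      have il := treeInsert_time k l
      have ir := treeInsert_time k r
      have hc := keyCmp_time k x
      have hl := Nat.mul_le_mul_right (k.length + 2) (le_max_left (treeDepth l) (treeDepth r))
      have hr := Nat.mul_le_mul_right (k.length + 2) (le_max_right (treeDepth l) (treeDepth r))
      simp only [treeInsert, Timed.time_bind, Timed.time_tick, treeDepth, add_mul, one_mul]
      rcases (keyCmp k x).val with _ | _ | _ <;>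
        simp only [Timed.time_pure, Timed.time_bind] <;> omega

theorem treeInsert_val {n : ℕ} (k : List (Fin n)) :
    ∀ t, (treeInsert k t).val = Ordnode.insert k t
  | .nil => rfl
  | .node _ l x r => by
      have il := treeInsert_val k l
      have ir := treeInsert_val k r
      simp only [treeInsert, Timed.val_bind, keyCmp_val, Ordnode.insert]
      rcases cmpLE k x with _ | _ | _ <;> simp [il, ir]

theorem treeSearch_val {n : ℕ} (k : List (Fin n)) :
    ∀ {t o₁ o₂}, Ordnode.Bounded t o₁ o₂ → ((treeSearch k t).val = true ↔ Ordnode.Emem k t)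
  | .nil, _, _, _ => by simp [treeSearch, Ordnode.Emem, Ordnode.Any]
  | .node _ l x r, _, _, h => by
      have il := treeSearch_val k h.1
      have ir := treeSearch_val k h.2
      have hl := Ordnode.all_iff_forall.1 h.1.mem_lt
      have hr := Ordnode.all_iff_forall.1 h.2.mem_gt
      have hm : Ordnode.Emem k (.node ‹_› l x r) ↔ Ordnode.Emem k l ∨ k = x ∨ Ordnode.Emem k r :=
        Iff.rfl
      rw [hm]
      simp only [treeSearch, Timed.val_bind, keyCmp_val, cmpLE]
      split_ifs with h₁ h₂
      · simp [le_antisymm h₁ h₂]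
      · have : ¬ Ordnode.Emem k r := fun hk => h₂ (hr k hk).le
        have : k ≠ x := fun e => h₂ e.ge
        simp_all
      · have : ¬ Ordnode.Emem k l := fun hk => h₁ (hl k hk).le
        have : k ≠ x := fun e => h₁ e.le
        simp_all

/-- Rebalancing is controlled through `Ordnode.All`; taking for `p` the predicate "different from a
given key" turns this into membership after an insertion (`emem_iff_not_all`). -/
theorem all_insert {α : Type} [LinearOrder α] (p : α → Prop) (k : α) :
    ∀ {t o₁ o₂}, Ordnode.Valid' o₁ t o₂ → Ordnode.Bounded .nil o₁ k → Ordnode.Bounded .nil k o₂ →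
      (Ordnode.All p (Ordnode.insert k t) ↔ p k ∧ Ordnode.All p t)
  | .nil, _, _, _, _, _ => by
      change Ordnode.All p (Ordnode.singleton k) ↔ p k ∧ True
      simp [Ordnode.singleton, Ordnode.All]
  | .node _ l y r, _, _, h, bl, br => by
      have hall : ∀ s, Ordnode.All p (.node s l y r) ↔
        Ordnode.All p l ∧ p y ∧ Ordnode.All p r := fun _ => Iff.rfl
      have hall' : ∀ s, Ordnode.All p (.node s l k r) ↔
        Ordnode.All p l ∧ p k ∧ Ordnode.All p r := fun _ => Iff.rfl
      rw [Ordnode.insert, cmpLE, hall]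
      split_ifs with h₁ h₂ <;> dsimp only
      · obtain rfl := le_antisymm h₁ h₂
        rw [hall]; tauto
      · have hlt := lt_of_le_not_ge h₁ h₂
        have ih := all_insert p k h.left bl hlt
        obtain ⟨v, e⟩ := Ordnode.insertWith.valid_aux (fun _ => k) k (fun _ _ => ⟨le_rfl, le_rfl⟩)
          h.left bl hlt
        rw [← Ordnode.insert_eq_insertWith] at v e
        rw [Ordnode.all_balanceL v.3 h.3.2.2 v.2 h.2.2.2 (Or.inl ⟨_, e, h.3.1⟩), ih]
        tauto
      · have hlt := not_le.1 h₁
        have ih := all_insert p k h.right hlt br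
        obtain ⟨v, e⟩ := Ordnode.insertWith.valid_aux (fun _ => k) k (fun _ _ => ⟨le_rfl, le_rfl⟩)
          h.right hlt br
        rw [← Ordnode.insert_eq_insertWith] at v e
        rw [Ordnode.all_balanceR h.3.2.1 v.3 h.2.2.1 v.2 (Or.inr ⟨_, e, h.3.1⟩), ih]
        tauto

theorem emem_iff_not_all {α : Type} (k : α) (t : Ordnode α) :
    Ordnode.Emem k t ↔ ¬ Ordnode.All (fun x => x ≠ k) t := by
  rw [Ordnode.all_iff_forall]
  constructor
  · intro h h'
    exact h' k h rfl
  · intro h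
    by_contra hk
    exact h fun x hx e => hk (e ▸ hx)

/-- Correctness and cost of the search tree. -/
def searchTreeSpec (n : ℕ) : TableSpec (searchTree n) where
  Rep t K := t.Valid ∧ (∀ k, k ∈ K ↔ Ordnode.Emem k t) ∧ t.size ≤ K.card
  cost t := (3 * Nat.log 2 (t.size + 1) + 3) * (n + 2) + 1
  rep_empty := ⟨Ordnode.valid_nil, fun k => by
    simp [searchTree, Ordnode.Emem, Ordnode.Any], by simp [searchTree]⟩
  search_val := fun {t K} h k => by
    rw [h.2.1 k]; exact treeSearch_val k h.1.1
  rep_insert := fun {t K} h k hk => by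
    obtain ⟨v, e⟩ := Ordnode.insertWith.valid_aux (fun _ => k) k (fun _ _ => ⟨le_rfl, le_rfl⟩)
      h.1 trivial trivial
    rw [← Ordnode.insert_eq_insertWith] at v e
    change Ordnode.Valid (treeInsert k t).val ∧ (∀ x, _ ↔ Ordnode.Emem x (treeInsert k t).val) ∧
      (treeInsert k t).val.size ≤ _
    rw [treeInsert_val]
    refine ⟨v, fun x => ?_, ?_⟩
    · rw [Finset.mem_insert, h.2.1, emem_iff_not_all, emem_iff_not_all,
        all_insert _ k h.1 trivial trivial]
      rw [not_and_or, not_not, eq_comm]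
    · rw [Finset.card_insert_of_notMem hk]
      have := (Ordnode.raised_iff.1 e).2
      have := h.2.2
      omega
  search_time := fun {t K} h k hk => by
    have h₁ := treeSearch_time k t
    have h₂ := treeDepth_le t h.1.2 h.1.3
    exact h₁.trans (Nat.add_le_add_right (Nat.mul_le_mul h₂ (by omega)) 1)
  insert_time := fun {t K} h k hk => by
    have h₁ := treeInsert_time k t
    have h₂ := treeDepth_le t h.1.2 h.1.3
    exact h₁.trans (Nat.add_le_add_right (Nat.mul_le_mul h₂ (by omega)) 1)
  cost_mono := fun {t K} h k hk => by
    obtain ⟨v, e⟩ := Ordnode.insertWith.valid_aux (fun _ => k) k (fun _ _ => ⟨le_rfl, le_rfl⟩)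
      h.1 trivial trivial
    rw [← Ordnode.insert_eq_insertWith] at v e
    change _ ≤ (3 * Nat.log 2 ((treeInsert k t).val.size + 1) + 3) * (n + 2) + 1
    rw [treeInsert_val]
    have := (Ordnode.raised_iff.1 e).1
    gcongr

/-! ### The hash table -/

theorem chainSearch_val {n : ℕ} (k : List (Fin n)) :
    ∀ l, (chainSearch k l).val = true ↔ k ∈ l
  | [] => by simp [chainSearch]
  | x :: l => by
      have ih := chainSearch_val k l
      simp only [chainSearch, Timed.val_bind, keyCmp_val, cmpLE, List.mem_cons]
      split_ifs with h₁ h₂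
      · simp [le_antisymm h₁ h₂]
      · have : k ≠ x := fun e => h₂ e.ge
        simp_all
      · have : k ≠ x := fun e => h₁ e.le
        simp_all

theorem chainSearch_time {n : ℕ} (k : List (Fin n)) :
    ∀ l, (chainSearch k l).time ≤ l.length * (k.length + 2) + 1
  | [] => by simp [chainSearch]
  | x :: l => by
      have ih := chainSearch_time k l
      have hc := keyCmp_time k x
      simp only [chainSearch, Timed.time_bind, Timed.time_tick, List.length_cons, add_mul, one_mul]
      rcases (keyCmp k x).val with _ | _ | _ <;> simp only [Timed.time_pure] <;> omega

/-- Correctness and cost of the hash table. -/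
def hashTableSpec {n b : ℕ} (hash : List (Fin n) → Fin b) : TableSpec (hashTable hash) where
  Rep t K := (∀ k, k ∈ K ↔ k ∈ t (hash k)) ∧ ∀ i, (t i).length ≤ K.card
  cost t := (Finset.univ.sup fun i => (t i).length) * (n + 2) + (n + 2)
  rep_empty := ⟨fun k => by simp [hashTable], fun i => by simp [hashTable]⟩
  search_val := fun {t K} h k => by
    rw [h.1 k]; exact chainSearch_val k _
  rep_insert := fun {t K} h k hk => by
    refine ⟨fun x => ?_, fun i => ?_⟩
    · change _ ↔ x ∈ Function.update t (hash k) (k :: t (hash k)) (hash x)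
      rw [Finset.mem_insert, h.1]
      by_cases e : hash x = hash k
      · simp [e]
      · rw [Function.update_of_ne e]
        constructor
        · rintro (rfl | hx)
          · exact absurd rfl e
          · exact hx
        · exact Or.inr
    · change (Function.update t (hash k) (k :: t (hash k)) i).length ≤ _
      rw [Finset.card_insert_of_notMem hk]
      have := h.2 i
      by_cases e : i = hash k
      · subst e; simpa using this
      · rw [Function.update_of_ne e]; omega
  search_time := fun {t K} h k hk => by
    have h₁ := chainSearch_time k (t (hash k))
    have h₂ : (t (hash k)).length ≤ Finset.univ.sup fun i => (t i).length :=
      Finset.le_sup (f := fun i => (t i).length) (Finset.mem_univ _)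
    have h₃ := Nat.mul_le_mul h₂ (show k.length + 2 ≤ n + 2 by omega)
    change k.length + 1 + (chainSearch k (t (hash k))).time ≤ _
    omega
  insert_time := fun {t K} h k hk => by
    change k.length + 2 + 0 ≤ _
    omega
  cost_mono := fun {t K} h k hk => by
    change _ ≤ (Finset.univ.sup fun i =>
      (Function.update t (hash k) (k :: t (hash k)) i).length) * (n + 2) + (n + 2)
    gcongr with i
    by_cases e : i = hash k
    · subst e; simp
    · rw [Function.update_of_ne e]

/-! ### Merge sort -/

section Sorting

variable {α : Type} (v : α → ℝ)

theorem merge_perm : ∀ l r : List α, (merge v l r).val.Perm (l ++ r)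
  | [], r => by simp [merge]
  | a :: l, [] => by simp [merge]
  | a :: l, b :: r => by
      have h₁ := merge_perm l (b :: r)
      have h₂ := merge_perm (a :: l) r
      rw [merge]
      simp only [Timed.val_bind, Timed.val_ite, Timed.val_pure]
      split_ifs
      · exact h₁.cons a
      · exact (h₂.cons b).trans List.perm_middle.symm
termination_by l r => l.length + r.length

theorem merge_time : ∀ l r : List α, (merge v l r).time ≤ l.length + r.length
  | [], r => by simp [merge]
  | a :: l, [] => by simp [merge]
  | a :: l, b :: r => by
      have h₁ := merge_time l (b :: r)
      have h₂ := merge_time (a :: l) r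
      rw [merge]
      simp only [Timed.time_bind, Timed.time_ite, Timed.time_pure, Timed.time_tick]
      simp only [List.length_cons] at *
      split_ifs <;> omega
termination_by l r => l.length + r.length

theorem merge_sorted : ∀ l r : List α, l.Pairwise (fun a b => v a ≤ v b) →
    r.Pairwise (fun a b => v a ≤ v b) → (merge v l r).val.Pairwise (fun a b => v a ≤ v b)
  | [], r, _, hr => by simpa [merge] using hr
  | a :: l, [], hl, _ => by simpa [merge] using hl
  | a :: l, b :: r, hl, hr => by
      have h₁ := merge_sorted l (b :: r) hl.of_cons hr
      have h₂ := merge_sorted (a :: l) r hl hr.of_cons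
      have hl' := List.pairwise_cons.1 hl
      have hr' := List.pairwise_cons.1 hr
      rw [merge]
      simp only [Timed.val_bind, Timed.val_ite, Timed.val_pure]
      split_ifs with h
      · refine List.pairwise_cons.2 ⟨fun x hx => ?_, h₁⟩
        have := (merge_perm v l (b :: r)).mem_iff.1 hx
        simp only [List.mem_append, List.mem_cons] at this
        rcases this with hx | rfl | hx
        · exact hl'.1 x hx
        · exact h
        · exact h.trans (hr'.1 x hx)
      · refine List.pairwise_cons.2 ⟨fun x hx => ?_, h₂⟩
        have := (merge_perm v (a :: l) r).mem_iff.1 hx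
        simp only [List.mem_append, List.mem_cons] at this
        push Not at h
        rcases this with (rfl | hx) | hx
        · exact h.le
        · exact h.le.trans (hl'.1 x hx)
        · exact hr'.1 x hx
termination_by l r => l.length + r.length

theorem mergeSort_perm : ∀ l : List α, (mergeSort v l).val.Perm l
  | [] => by simp [mergeSort]
  | [a] => by simp [mergeSort]
  | a :: b :: l => by
      have h₁ := mergeSort_perm ((a :: b :: l).take ((l.length + 2) / 2))
      have h₂ := mergeSort_perm ((a :: b :: l).drop ((l.length + 2) / 2))
      rw [mergeSort]
      simp only [Timed.val_bind]
      refine (merge_perm v _ _).trans ((h₁.append h₂).trans ?_)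
      rw [List.take_append_drop]
termination_by l => l.length
decreasing_by
  · simp only [List.length_take, List.length_cons]; omega
  · simp only [List.length_drop, List.length_cons]; omega

theorem mergeSort_sorted : ∀ l : List α, (mergeSort v l).val.Pairwise (fun a b => v a ≤ v b)
  | [] => by simp [mergeSort]
  | [a] => by simp [mergeSort]
  | a :: b :: l => by
      have h₁ := mergeSort_sorted ((a :: b :: l).take ((l.length + 2) / 2))
      have h₂ := mergeSort_sorted ((a :: b :: l).drop ((l.length + 2) / 2))
      rw [mergeSort]
      simp only [Timed.val_bind]
      exact merge_sorted v _ _ h₁ h₂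
termination_by l => l.length
decreasing_by
  · simp only [List.length_take, List.length_cons]; omega
  · simp only [List.length_drop, List.length_cons]; omega

/-- A quadratic bound is enough: testing up to `n` runs in a column already costs of order `n * m`
each, which dominates the sorting. -/
theorem mergeSort_time : ∀ l : List α, (mergeSort v l).time ≤ 2 * l.length ^ 2
  | [] => by simp [mergeSort]
  | [a] => by simp [mergeSort]
  | a :: b :: l => by
      have h₁ := mergeSort_time ((a :: b :: l).take ((l.length + 2) / 2))
      have h₂ := mergeSort_time ((a :: b :: l).drop ((l.length + 2) / 2))
      have h₃ := merge_time v (mergeSort v ((a :: b :: l).take ((l.length + 2) / 2))).val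
        (mergeSort v ((a :: b :: l).drop ((l.length + 2) / 2))).val
      rw [(mergeSort_perm v _).length_eq, (mergeSort_perm v _).length_eq] at h₃
      rw [mergeSort]
      simp only [Timed.time_bind, Timed.time_charge]
      simp only [List.length_take, List.length_drop, List.length_cons] at *
      obtain ⟨p, hp⟩ : ∃ p, p = min ((l.length + 2) / 2) (l.length + 1 + 1) := ⟨_, rfl⟩
      obtain ⟨q, hq⟩ : ∃ q, q = l.length + 1 + 1 - (l.length + 2) / 2 := ⟨_, rfl⟩
      rw [← hp] at h₁ h₃
      rw [← hq] at h₂ h₃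
      have hpq : l.length + 1 + 1 = p + q := by omega
      have hp1 : 1 ≤ p := by omega
      have hq1 : 1 ≤ q := by omega
      have h₄ : p + q ≤ 2 * (p * q) := by
        nlinarith [Nat.mul_le_mul_left q hp1, Nat.mul_le_mul_left p hq1]
      have hsq : (l.length + 1 + 1) ^ 2 = (p + q) ^ 2 := by rw [hpq]
      rw [hsq]
      have : 2 * (p + q) ^ 2 = 2 * p ^ 2 + 2 * q ^ 2 + 4 * (p * q) := by ring
      omega
termination_by l => l.length
decreasing_by
  · simp only [List.length_take, List.length_cons]; omega
  · simp only [List.length_drop, List.length_cons]; omega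

/-! ### Extrema -/

theorem extrema_time : ∀ l : List α, (extrema v l).time ≤ l.length
  | [] => by simp [extrema]
  | [a] => by simp [extrema]
  | a :: b :: l => by
      have := extrema_time (b :: l)
      simp only [extrema, Timed.time_bind, Timed.time_tick, Timed.time_pure] at *
      simp only [List.length_cons] at *
      omega

theorem extrema_fst_le_iff {l : List α} (hl : l ≠ []) (c : ℝ) :
    (extrema v l).val.1 ≤ c ↔ ∀ a ∈ l, v a ≤ c := by
  match l, hl with
  | [a], _ => simp [extrema]
  | a :: b :: l, _ =>
    have := extrema_fst_le_iff (l := b :: l) (by simp) c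
    simp only [extrema, Timed.val_bind, Timed.val_pure, max_le_iff, this, List.forall_mem_cons]

theorem le_extrema_snd_iff {l : List α} (hl : l ≠ []) (c : ℝ) :
    c ≤ (extrema v l).val.2 ↔ ∀ a ∈ l, c ≤ v a := by
  match l, hl with
  | [a], _ => simp [extrema]
  | a :: b :: l, _ =>
    have := le_extrema_snd_iff (l := b :: l) (by simp) c
    simp only [extrema, Timed.val_bind, Timed.val_pure, le_min_iff, this, List.forall_mem_cons]

theorem extrema_sub_le_iff {l : List α} (hl : l ≠ []) (c : ℝ) :
    (extrema v l).val.1 - (extrema v l).val.2 ≤ c ↔ ∀ a ∈ l, ∀ b ∈ l, v a - v b ≤ c := by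
  rw [sub_le_iff_le_add', extrema_fst_le_iff v hl]
  constructor
  · intro h a ha b hb
    have h₁ := h a ha
    have h₂ := (le_extrema_snd_iff v hl (extrema v l).val.2).1 le_rfl b hb
    linarith
  · intro h a ha
    rw [← sub_le_iff_le_add, le_extrema_snd_iff v hl]
    intro b hb
    linarith [h a ha b hb]

/-- Lets the extrema of a column be computed once and then be reused for every row of `Γ`, so that
the row-maximality test takes `O(n * m)` steps. -/
theorem max_extrema_sub_le_iff {l : List α} (hl : l ≠ []) (g : α) (c : ℝ) :
    max (v g) (extrema v l).val.1 - min (v g) (extrema v l).val.2 ≤ c ↔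
      ∀ a ∈ g :: l, ∀ b ∈ g :: l, v a - v b ≤ c := by
  rw [← extrema_sub_le_iff v (by simp)]
  obtain ⟨b, l, rfl⟩ := List.exists_cons_of_ne_nil hl
  simp [extrema]

/-! ### Order statistics -/

/-- Pigeonhole: only `p` entries precede position `p`, so a set with more than `p` elements has one
at or after it. -/
theorem exists_mem_getElem_rel [DecidableEq α] {r : α → α → Prop} (hrefl : ∀ a, r a a) {w : List α}
    (hw : w.Pairwise r) {M : Finset α} (hM : ∀ a ∈ M, a ∈ w) {p : ℕ} (hp : p < M.card)
    (hpw : p < w.length) : ∃ a ∈ M, r w[p] a := by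
  obtain ⟨a, haM, ha⟩ : ∃ a ∈ M, a ∉ (w.take p).toFinset := by
    by_contra! h
    have h₁ := Finset.card_le_card (show M ⊆ (w.take p).toFinset from h)
    have h₂ := List.toFinset_card_le (w.take p)
    rw [List.length_take] at h₂
    omega
  refine ⟨a, haM, ?_⟩
  have hmem : a ∈ w.drop p := by
    have := hM a haM
    rw [← List.take_append_drop p w, List.mem_append] at this
    simpa using this.resolve_left (by simpa using ha)
  have hd : (w.drop p).Pairwise r := hw.sublist (List.drop_sublist _ _)
  rw [List.drop_eq_getElem_cons hpw] at hmem hd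
  rcases List.mem_cons.1 hmem with rfl | h
  · exact hrefl _
  · exact (List.pairwise_cons.1 hd).1 a h

end Sorting

/-! ### Runs in a sorted list -/

section Runs

variable {n m : ℕ} (P : Input n m) (j : Fin m)

theorem takeWithin_prefix (x : ℝ) : ∀ l : List (Fin n), (takeWithin P j x l).val <+: l
  | [] => by simp [takeWithin]
  | i :: l => by
      have ih := takeWithin_prefix x l
      simp only [takeWithin, Timed.val_bind, Timed.val_ite, Timed.val_pure]
      split_ifs
      · exact (List.prefix_cons_inj i).2 ih
      · exact List.nil_prefix

theorem takeWithin_length_le_of_imp {x y : ℝ} : ∀ l : List (Fin n),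
    (∀ a ∈ l, P.A a j - x ≤ P.ε → P.A a j - y ≤ P.ε) →
    (takeWithin P j x l).val.length ≤ (takeWithin P j y l).val.length
  | [], _ => by simp [takeWithin]
  | i :: l, h => by
      have ih := takeWithin_length_le_of_imp l fun a ha => h a (List.mem_cons_of_mem _ ha)
      have hi := h i List.mem_cons_self
      simp only [takeWithin, Timed.val_bind, Timed.val_ite, Timed.val_pure]
      split_ifs with h₁ h₂
      · simpa using ih
      · exact absurd (hi h₁) h₂
      · simp
      · simp

theorem takeWithin_time (x : ℝ) : ∀ l : List (Fin n), (takeWithin P j x l).time ≤ l.length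
  | [] => by simp [takeWithin]
  | i :: l => by
      have ih := takeWithin_time x l
      simp only [takeWithin, Timed.time_bind, Timed.time_ite, Timed.time_pure, Timed.time_tick,
        List.length_cons]
      split_ifs <;> omega

theorem newRowSets_time : ∀ (p : ℕ) (l : List (Fin n)),
    (newRowSets P j p l).time ≤ l.length * (2 * l.length + 1)
  | _, [] => by simp [newRowSets]
  | p, i :: l => by
      have h₁ := takeWithin_time P j (P.A i j) (i :: l)
      have h₂ := (takeWithin_prefix P j (P.A i j) (i :: l)).length_le
      have ih := newRowSets_time (takeWithin P j (P.A i j) (i :: l)).val.length l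
      simp only [newRowSets, Timed.time_bind, Timed.time_charge, Timed.time_pure]
      simp only [List.length_cons] at *
      nlinarith

theorem newRowSets_length_le : ∀ (p : ℕ) (l : List (Fin n)),
    (newRowSets P j p l).val.length ≤ l.length
  | _, [] => by simp [newRowSets]
  | p, i :: l => by
      have ih := newRowSets_length_le (takeWithin P j (P.A i j) (i :: l)).val.length l
      simp only [newRowSets, Timed.val_bind, Timed.val_pure]
      split_ifs <;> simp only [List.length_cons] <;> omega

theorem mem_takeWithin_iff {x : ℝ} : ∀ {l : List (Fin n)},
    l.Pairwise (fun a b => P.A a j ≤ P.A b j) →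
    ∀ {a}, a ∈ (takeWithin P j x l).val ↔ a ∈ l ∧ P.A a j - x ≤ P.ε
  | [], _, a => by simp [takeWithin]
  | i :: l, hl, a => by
      have hl' := List.pairwise_cons.1 hl
      have ih := mem_takeWithin_iff (x := x) hl'.2 (a := a)
      simp only [takeWithin, Timed.val_bind, Timed.val_ite, Timed.val_pure]
      split_ifs with h
      · rw [List.mem_cons, ih, List.mem_cons]
        constructor
        · rintro (rfl | ⟨h₁, h₂⟩)
          · exact ⟨Or.inl rfl, h⟩
          · exact ⟨Or.inr h₁, h₂⟩
        · rintro ⟨rfl | h₁, h₂⟩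
          · exact Or.inl rfl
          · exact Or.inr ⟨h₁, h₂⟩
      · simp only [List.not_mem_nil, List.mem_cons, false_iff, not_and, not_le]
        rintro (rfl | ha)
        · linarith
        · linarith [hl'.1 a ha]

theorem subset_takeWithin_of_length_le {x y : ℝ} {l : List (Fin n)}
    (h : (takeWithin P j x l).val.length ≤ (takeWithin P j y l).val.length) :
    (takeWithin P j x l).val ⊆ (takeWithin P j y l).val :=
  (List.prefix_of_prefix_length_le (takeWithin_prefix P j x l) (takeWithin_prefix P j y l)
    h).subset

end Runs

/-! ### Perturbation as pairwise closeness -/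

/-- All values of column `j` on the rows `I` are within `ε` of each other. -/
def Within {n m : ℕ} (A : Matrix (Fin n) (Fin m) ℝ) (ε : ℝ) (I : Finset (Fin n)) (j : Fin m) :
    Prop :=
  ∀ a ∈ I, ∀ b ∈ I, A a j - A b j ≤ ε

theorem Within.mono {n m : ℕ} {A : Matrix (Fin n) (Fin m) ℝ} {ε : ℝ} {I I' : Finset (Fin n)}
    {j : Fin m} (h : Within A ε I' j) (hI : I ⊆ I') : Within A ε I j :=
  fun a ha b hb => h a (hI ha) b (hI hb)

/-- The empty row-set has `spread` equal to 0 by convention; it agrees with the vacuous pairwise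
condition because `0 ≤ ε`. -/
theorem spread_le_iff {n m : ℕ} {A : Matrix (Fin n) (Fin m) ℝ} {ε : ℝ} (hε : 0 ≤ ε)
    {I : Finset (Fin n)} {j : Fin m} : spread A I j ≤ ε ↔ Within A ε I j := by
  unfold spread Within
  split_ifs with h
  · rw [sub_le_iff_le_add', Finset.sup'_le_iff]
    constructor
    · intro h' a ha b hb
      have h₁ := h' a ha
      have h₂ : I.inf' h (fun i => A i j) ≤ A b j := Finset.inf'_le (fun i => A i j) hb
      linarith
    · intro h' a ha
      rw [← sub_le_iff_le_add, Finset.le_inf'_iff]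
      intro b hb
      linarith [h' a ha b hb]
  · rw [Finset.not_nonempty_iff_eq_empty] at h
    subst h
    simpa using hε

/-! ### Inclusion-maximal runs of a sorted column -/

section Runs

variable {n m : ℕ} (P : Input n m) (j : Fin m)

/-- `M` is an inclusion-maximal subset of `I` with perturbation at most `ε` in column `j`. -/
def IsMaxRun (I M : Finset (Fin n)) : Prop :=
  M ⊆ I ∧ Within P.A P.ε M j ∧ ∀ x ∈ I, x ∉ M → ¬ Within P.A P.ε (insert x M) j

theorem takeWithin_self_cons (hε : 0 ≤ P.ε) (i : Fin n) (l : List (Fin n)) :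
    (takeWithin P j (P.A i j) (i :: l)).val = i :: (takeWithin P j (P.A i j) l).val := by
  rw [takeWithin]
  simp [hε]

theorem within_takeWithin {i : Fin n} {l : List (Fin n)}
    (hl : (i :: l).Pairwise (fun a b => P.A a j ≤ P.A b j)) :
    Within P.A P.ε (takeWithin P j (P.A i j) (i :: l)).val.toFinset j := by
  intro a ha b hb
  rw [List.mem_toFinset, mem_takeWithin_iff P j hl] at ha hb
  have : P.A i j ≤ P.A b j := by
    rcases List.mem_cons.1 hb.1 with rfl | h
    · exact le_rfl
    · exact (List.pairwise_cons.1 hl).1 b h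
  linarith [ha.2]

/-- Every scrolled run is inclusion-maximal; `pre` is the part of the list already scrolled. -/
theorem newRowSets_sound (hε : 0 ≤ P.ε) : ∀ (pre l : List (Fin n)) (p : ℕ),
    (pre ++ l).Pairwise (fun a b => P.A a j ≤ P.A b j) →
    (∀ x ∈ pre, (takeWithin P j (P.A x j) l).val.length + 1 ≤ p) →
    ∀ w ∈ (newRowSets P j p l).val, w.Sublist l ∧ w ≠ [] ∧
      IsMaxRun P j (pre ++ l).toFinset w.toFinset
  | _, [], _, _, _ => by simp [newRowSets]
  | pre, i :: l, p, hs, hp => by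
      have e : pre ++ i :: l = (pre ++ [i]) ++ l := by simp
      have hil : (i :: l).Pairwise (fun a b => P.A a j ≤ P.A b j) :=
        (List.pairwise_append.1 hs).2.1
      have hpre : ∀ x ∈ pre, ∀ a ∈ i :: l, P.A x j ≤ P.A a j := (List.pairwise_append.1 hs).2.2
      have hcons := takeWithin_self_cons P j hε i l
      have ih := newRowSets_sound hε (pre ++ [i]) l
        (takeWithin P j (P.A i j) (i :: l)).val.length (e ▸ hs) (by
          intro x hx
          -- The new `p` is the reach of `i` into `l` plus one for `i` itself; earlier rows have
          -- smaller values and reach no further.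
          rw [hcons, List.length_cons]
          rw [List.mem_append, List.mem_singleton] at hx
          rcases hx with hx | rfl
          · have := takeWithin_length_le_of_imp P j (x := P.A x j) (y := P.A i j) l
              fun a _ _ => by linarith [hpre x hx i (by simp)]
            omega
          · exact le_rfl)
      intro w hw
      have hw' : w ∈ (newRowSets P j (takeWithin P j (P.A i j) (i :: l)).val.length l).val ∨
          w = (takeWithin P j (P.A i j) (i :: l)).val ∧
            p ≤ (takeWithin P j (P.A i j) (i :: l)).val.length := by
        simp only [newRowSets, Timed.val_bind, Timed.val_pure] at hw
        split_ifs at hw with h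
        · rcases List.mem_cons.1 hw with hw | hw
          · exact Or.inr ⟨hw, h⟩
          · exact Or.inl hw
        · exact Or.inl hw
      rcases hw' with hw' | ⟨rfl, hpw⟩
      · obtain ⟨h₁, h₂, h₃⟩ := ih w hw'
        exact ⟨h₁.cons i, h₂, e ▸ h₃⟩
      · refine ⟨(takeWithin_prefix P j _ _).sublist, by rw [hcons]; simp, ?_,
          within_takeWithin P j hil, ?_⟩
        · intro a ha
          rw [List.mem_toFinset] at ha ⊢
          exact List.mem_append_right _ ((takeWithin_prefix P j _ _).subset ha)
        · intro x hx hxw hwi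
          rw [List.mem_toFinset] at hx hxw
          have hi : i ∈ (takeWithin P j (P.A i j) (i :: l)).val := by rw [hcons]; simp
          rcases List.mem_append.1 hx with hx | hx
          · have h₁ := hp x hx
            have h₂ := takeWithin_length_le_of_imp P j (x := P.A i j) (y := P.A x j) (i :: l)
              fun a ha hai => hwi a
                (by simp [(mem_takeWithin_iff P j hil).2 ⟨ha, hai⟩]) x (by simp)
            omega
          · apply hxw
            rw [mem_takeWithin_iff P j hil]
            exact ⟨hx, hwi x (by simp) i (by simp [hi])⟩

/-- Every inclusion-maximal set of rows with perturbation at most `ε` is scrolled. -/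
theorem newRowSets_complete (hε : 0 ≤ P.ε) {M : Finset (Fin n)} (hM : M.Nonempty) :
    ∀ (pre l : List (Fin n)) (p : ℕ),
    (pre ++ l).Pairwise (fun a b => P.A a j ≤ P.A b j) → (pre ++ l).Nodup →
    (p = 0 ∨ ∃ x ∈ pre, p ≤ (takeWithin P j (P.A x j) l).val.length + 1) →
    IsMaxRun P j (pre ++ l).toFinset M → (∀ a ∈ M, a ∈ l) →
    ∃ w ∈ (newRowSets P j p l).val, w.toFinset = M
  | _, [], _, _, _, _, _, h => by
      obtain ⟨a, ha⟩ := hM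
      simpa using h a ha
  | pre, i :: l, p, hs, hn, hp, hmax, hMl => by
      have e : pre ++ i :: l = (pre ++ [i]) ++ l := by simp
      have hil : (i :: l).Pairwise (fun a b => P.A a j ≤ P.A b j) :=
        (List.pairwise_append.1 hs).2.1
      have hpre : ∀ x ∈ pre, ∀ a ∈ i :: l, P.A x j ≤ P.A a j := (List.pairwise_append.1 hs).2.2
      have hcons := takeWithin_self_cons P j hε i l
      -- When the scroll meets the first row of `M`, all of `M` is still ahead, and the run starting
      -- there contains `M`, hence equals it.
      by_cases hiM : i ∈ M
      · have hsub : M ⊆ (takeWithin P j (P.A i j) (i :: l)).val.toFinset := by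
          intro a ha
          rw [List.mem_toFinset, mem_takeWithin_iff P j hil]
          exact ⟨hMl a ha, hmax.2.1 a ha i hiM⟩
        have heq : (takeWithin P j (P.A i j) (i :: l)).val.toFinset = M := by
          refine Finset.Subset.antisymm (fun x hx => ?_) hsub
          by_contra hxM
          refine hmax.2.2 x ?_ hxM ((within_takeWithin P j hil).mono ?_)
          · rw [List.mem_toFinset] at hx ⊢
            exact List.mem_append_right _ ((takeWithin_prefix P j _ _).subset hx)
          · exact Finset.insert_subset hx hsub
        refine ⟨_, ?_, heq⟩
        simp only [newRowSets, Timed.val_bind, Timed.val_pure]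
        rw [if_pos]
        · simp
        · rcases hp with rfl | ⟨x, hx, hpx⟩
          · simp
          -- A run that is skipped lies within the reach of an earlier row `x`, which could then be
          -- added to `M`.
          · by_contra hlt
            have hle : (takeWithin P j (P.A i j) (i :: l)).val.length ≤
              (takeWithin P j (P.A x j) (i :: l)).val.length := by omega
            have hss := subset_takeWithin_of_length_le P j hle
            have hxl : x ∉ i :: l := fun h => (List.nodup_append.1 hn).2.2 x hx x h rfl
            refine hmax.2.2 x (by simp [hx]) (fun h => hxl (hMl x h)) ?_
            have hw : ∀ a ∈ M, P.A a j - P.A x j ≤ P.ε ∧ P.A x j ≤ P.A a j := by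
              intro a ha
              have h₁ := hss (List.mem_toFinset.1 (hsub ha))
              rw [mem_takeWithin_iff P j hil] at h₁
              exact ⟨h₁.2, hpre x hx a h₁.1⟩
            intro a ha b hb
            rw [Finset.mem_insert] at ha hb
            rcases ha with rfl | ha <;> rcases hb with rfl | hb
            · simpa using hε
            · linarith [(hw b hb).2]
            · exact (hw a ha).1
            · exact hmax.2.1 a ha b hb
      · obtain ⟨w, hw, hwM⟩ := newRowSets_complete hε hM (pre ++ [i]) l
          (takeWithin P j (P.A i j) (i :: l)).val.length (e ▸ hs) (e ▸ hn)
          (Or.inr ⟨i, by simp, by rw [hcons, List.length_cons]⟩) (e ▸ hmax) (by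
            intro a ha
            rcases List.mem_cons.1 (hMl a ha) with rfl | h
            · exact absurd ha hiM
            · exact h)
        refine ⟨w, ?_, hwM⟩
        simp only [newRowSets, Timed.val_bind, Timed.val_pure]
        split_ifs
        · exact List.mem_cons_of_mem _ hw
        · exact hw

end Runs

/-! ### Closures and row-maximality -/

section Closure

variable {n m : ℕ} (P : Input n m)

open Classical in
/-- All columns on which the rows `I` have perturbation at most `ε`. -/
noncomputable def closedCols (I : Finset (Fin n)) : Finset (Fin m) :=
  Finset.univ.filter fun k => Within P.A P.ε I k

/-- The columns of `closedCols` with index less than `y`. -/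
noncomputable def closedBelow (I : Finset (Fin n)) (y : ℕ) : Finset (Fin m) :=
  (closedCols P I).filter fun k => k.val < y

/-- No row can be added to `I` when the columns are `H`. -/
def RowMaximal (I : Finset (Fin n)) (H : Finset (Fin m)) : Prop :=
  ∀ x, x ∉ I → ∃ k ∈ H, ¬ Within P.A P.ε (insert x I) k

variable {P}

@[simp] theorem mem_closedCols {I : Finset (Fin n)} {k : Fin m} :
    k ∈ closedCols P I ↔ Within P.A P.ε I k := by simp [closedCols]

@[simp] theorem mem_closedBelow {I : Finset (Fin n)} {y : ℕ} {k : Fin m} :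
    k ∈ closedBelow P I y ↔ Within P.A P.ε I k ∧ k.val < y := by simp [closedBelow]

theorem RowMaximal.mono {I : Finset (Fin n)} {H H' : Finset (Fin m)} (h : RowMaximal P I H)
    (hH : H ⊆ H') : RowMaximal P I H' := fun x hx =>
  let ⟨k, hk, hk'⟩ := h x hx
  ⟨k, hH hk, hk'⟩

variable (P)

/-! ### The tests on a new row-set -/

theorem isCanonical_val {G : List (Fin n)} (hG : G ≠ []) (J : Finset (Fin m)) :
    ∀ ks : List (Fin m), (isCanonical P G J ks).val = true ↔
      ∀ k ∈ ks, k ∉ J → ¬ Within P.A P.ε G.toFinset k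
  | [] => by simp [isCanonical]
  | k :: ks => by
      have ih := isCanonical_val hG J ks
      have he : (extrema (fun i => P.A i k) G).val.1 - (extrema (fun i => P.A i k) G).val.2 ≤ P.ε ↔
          Within P.A P.ε G.toFinset k := by
        rw [extrema_sub_le_iff _ hG]; simp [Within]
      simp only [isCanonical, Timed.val_bind, Timed.val_ite, Timed.val_pure,
        List.forall_mem_cons]
      split_ifs with h₁ h₂
      · simp [ih, h₁]
      · simp [h₁, he.1 h₂]
      · simp [ih, h₁, mt he.2 h₂]

theorem isCanonical_time (G : List (Fin n)) (J : Finset (Fin m)) :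
    ∀ ks : List (Fin m), (isCanonical P G J ks).time ≤ ks.length * (G.length + 1)
  | [] => by simp [isCanonical]
  | k :: ks => by
      have ih := isCanonical_time G J ks
      have he := extrema_time (fun i => P.A i k) G
      simp only [isCanonical, Timed.time_bind, Timed.time_ite, Timed.time_pure, Timed.time_tick,
        List.length_cons, add_mul, one_mul]
      split_ifs <;> omega

theorem columnBounds_val (G : List (Fin n)) (H : Finset (Fin m)) : ∀ ks : List (Fin m),
    (columnBounds P G H ks).val =
      (ks.filter fun k => decide (k ∈ H)).map fun k => (k, (extrema (fun i => P.A i k) G).val)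
  | [] => by simp [columnBounds]
  | k :: ks => by
      have ih := columnBounds_val G H ks
      simp only [columnBounds, Timed.val_bind, Timed.val_ite, Timed.val_pure, ih, List.filter_cons]
      split_ifs <;> simp_all

theorem columnBounds_time (G : List (Fin n)) (H : Finset (Fin m)) :
    ∀ ks : List (Fin m), (columnBounds P G H ks).time ≤ ks.length * (G.length + 1)
  | [] => by simp [columnBounds]
  | k :: ks => by
      have ih := columnBounds_time G H ks
      have he := extrema_time (fun i => P.A i k) G
      simp only [columnBounds, Timed.time_bind, Timed.time_ite, Timed.time_pure, Timed.time_tick,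
        List.length_cons, add_mul, one_mul]
      split_ifs <;> omega

theorem rowFits_val (g : Fin n) : ∀ es : List (Fin m × ℝ × ℝ),
    (rowFits P g es).val = true ↔
      ∀ e ∈ es, max (P.A g e.1) e.2.1 - min (P.A g e.1) e.2.2 ≤ P.ε
  | [] => by simp [rowFits]
  | e :: es => by
      have ih := rowFits_val g es
      simp only [rowFits, Timed.val_bind, Timed.val_ite, Timed.val_pure, List.forall_mem_cons]
      split_ifs with h
      · rw [ih]; exact ⟨fun h' => ⟨h, h'⟩, fun h' => h'.2⟩
      · exact ⟨fun h' => by simp at h', fun h' => absurd h'.1 h⟩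

theorem rowFits_time (g : Fin n) : ∀ es : List (Fin m × ℝ × ℝ),
    (rowFits P g es).time ≤ es.length
  | [] => by simp [rowFits]
  | e :: es => by
      have ih := rowFits_time g es
      simp only [rowFits, Timed.time_bind, Timed.time_ite, Timed.time_pure, Timed.time_tick,
        List.length_cons]
      split_ifs <;> omega

theorem noRowFits_val (es : List (Fin m × ℝ × ℝ)) : ∀ Γ : List (Fin n),
    (noRowFits P es Γ).val = true ↔ ∀ g ∈ Γ, ¬ (rowFits P g es).val = true
  | [] => by simp [noRowFits]
  | g :: Γ => by
      have ih := noRowFits_val es Γ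
      simp only [noRowFits, Timed.val_bind, Timed.val_ite, Timed.val_pure, List.forall_mem_cons]
      split_ifs with h
      · simp [h]
      · simp [ih, h]

theorem noRowFits_time (es : List (Fin m × ℝ × ℝ)) : ∀ Γ : List (Fin n),
    (noRowFits P es Γ).time ≤ Γ.length * (es.length + 1)
  | [] => by simp [noRowFits]
  | g :: Γ => by
      have ih := noRowFits_time es Γ
      have hg := rowFits_time P g es
      simp only [noRowFits, Timed.time_bind, Timed.time_ite, Timed.time_pure, Timed.time_tick,
        List.length_cons, add_mul, one_mul]
      split_ifs <;> omega

theorem isRowMaximal_val {G : List (Fin n)} (hG : G ≠ []) (H : Finset (Fin m))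
    (Γ : List (Fin n)) : (isRowMaximal P G H Γ).val = true ↔
      ∀ g ∈ Γ, ∃ k ∈ H, ¬ Within P.A P.ε (insert g G.toFinset) k := by
  simp only [isRowMaximal, Timed.val_bind, noRowFits_val, rowFits_val, columnBounds_val]
  refine forall₂_congr fun g _ => ?_
  have he : ∀ k, max (P.A g k) (extrema (fun i => P.A i k) G).val.1 -
      min (P.A g k) (extrema (fun i => P.A i k) G).val.2 ≤ P.ε ↔
      Within P.A P.ε (insert g G.toFinset) k := fun k => by
    rw [max_extrema_sub_le_iff (fun i => P.A i k) hG g]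
    simp [Within]
  rw [← not_iff_not]
  simp only [List.mem_map, List.mem_filter, List.mem_finRange, true_and, decide_eq_true_eq]
  push Not
  constructor
  · intro h k hk
    exact (he k).1 (h _ ⟨k, hk, rfl⟩)
  · rintro h _ ⟨k, hk, rfl⟩
    exact (he k).2 (h k hk)

theorem isRowMaximal_time (G : List (Fin n)) (H : Finset (Fin m)) (Γ : List (Fin n)) :
    (isRowMaximal P G H Γ).time ≤ m * (G.length + 1) + Γ.length * (m + 1) := by
  have h₁ := columnBounds_time P G H (List.finRange m)
  have h₂ := noRowFits_time P (columnBounds P G H (List.finRange m)).val Γ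
  have h₃ : (columnBounds P G H (List.finRange m)).val.length ≤ m := by
    rw [columnBounds_val, List.length_map]
    exact (List.length_filter_le _ _).trans (by simp)
  have h₄ := Nat.mul_le_mul_left Γ.length (Nat.add_le_add_right h₃ 1)
  simp only [isRowMaximal, Timed.time_bind]
  rw [List.length_finRange] at h₁
  omega

/-! ### Pivots -/

/-- Both pivot inequalities hold for a row that fits to `minRow` rows of the sorted run `w`. -/
theorem pivot_le {w : List (Fin n)} {j : Fin m}
    (hw : w.Pairwise (fun a b => P.A a j ≤ P.A b j)) {M : Finset (Fin n)}
    (hM : ∀ a ∈ M, a ∈ w) (hr : 1 ≤ P.minRow) (hc : P.minRow ≤ M.card) {x : Fin n}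
    (hx : Within P.A P.ε (insert x M) j) :
    (w.map fun i => P.A i j).getD (P.minRow - 1) 0 - P.A x j ≤ P.ε ∧
      P.A x j - (w.map fun i => P.A i j).reverse.getD (P.minRow - 1) 0 ≤ P.ε := by
  have hlen : M.card ≤ w.length :=
    (Finset.card_le_card (show M ⊆ w.toFinset from fun a ha => List.mem_toFinset.2 (hM a ha))).trans
      (List.toFinset_card_le w)
  constructor
  -- Some row `a` of `M` stands at index `minRow - 1` or later, so `p₁` is at most its value, which
  -- exceeds that of `x` by at most `ε`. The index is in range, so the default 0 plays no role. The
  -- second pivot is the same argument on the reversed list.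
  · obtain ⟨a, ha, h⟩ := exists_mem_getElem_rel (r := fun a b => P.A a j ≤ P.A b j)
      (fun _ => le_rfl) hw hM
      (p := P.minRow - 1) (by omega) (by omega)
    rw [List.getD_eq_getElem _ _ (by rw [List.length_map]; omega), List.getElem_map]
    linarith [hx a (by simp [ha]) x (by simp)]
  · obtain ⟨a, ha, h⟩ := exists_mem_getElem_rel (r := fun a b => P.A b j ≤ P.A a j)
      (fun _ => le_rfl) (List.pairwise_reverse.2 hw) (M := M)
      (fun a ha => List.mem_reverse.2 (hM a ha))
      (p := P.minRow - 1) (by omega) (by rw [List.length_reverse]; omega)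
    rw [← List.map_reverse, List.getD_eq_getElem _ _
      (by rw [List.length_map, List.length_reverse]; omega), List.getElem_map]
    linarith [hx x (by simp) a (by simp [ha])]

/-- The only property of the pivot rule that matters: it never discards a row satisfying both
inequalities. -/
theorem PivotRule.holds_of_and {p q : Prop} (h : p ∧ q) : ∀ r : PivotRule, r.Holds p q
  | .either => Or.inl h.1
  | .both => h

/-! ### Invariants of a call -/

/-- The invariant of a call with rows `I`, rows to check `Γ` and first attribute `y`. -/
structure Frame (I Γ : List (Fin n)) (y : ℕ) : Prop where
  sorted : I.Pairwise (· < ·)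
  minRow_le : P.minRow ≤ I.length
  rowMaximal : RowMaximal P I.toFinset (closedCols P I.toFinset)
  least : ∀ k, RowMaximal P I.toFinset (closedBelow P I.toFinset k) → y ≤ k
  nodup : Γ.Nodup
  disjoint : ∀ g ∈ Γ, g ∉ I
  cover : ∀ G ⊆ I.toFinset, P.minRow ≤ G.card → ∀ x, x ∉ I →
    (∀ k ∈ closedBelow P I.toFinset y, Within P.A P.ε (insert x G) k) → x ∈ Γ

/-- The columns `J` are closed for the rows `I`, as far as columns less than `y` are concerned. -/
structure ClosedUpTo (I : Finset (Fin n)) (J : Finset (Fin m)) (y : ℕ) : Prop where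
  within : ∀ k ∈ J, Within P.A P.ε I k
  mem : ∀ k : Fin m, k.val < y → Within P.A P.ε I k → k ∈ J

/-- The row-sets that have to be found in column `k` while the rows are `I`. -/
structure IsDescendant (I : Finset (Fin n)) (k : Fin m) (M : Finset (Fin n)) : Prop where
  isMaxRun : IsMaxRun P k I M
  minRow_le : P.minRow ≤ M.card
  canonical : ∀ k' < k, Within P.A P.ε M k' → Within P.A P.ε I k'
  rowMaximal : RowMaximal P M (closedBelow P M (k.val + 1))

/-- The queue `q` extends the keys `K` to the keys `K'`, and its entries are the arguments of
calls that satisfy the invariant. -/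
structure QueueSpec (I : Finset (Fin n)) (y : ℕ) (K : Finset (List (Fin n)))
    (q : List (Entry n m)) (K' : Finset (List (Fin n))) : Prop where
  mem_iff : ∀ G, G ∈ K' ↔ G ∈ K ∨ G ∈ q.map Entry.rows
  nodup : (q.map Entry.rows).Nodup
  fresh : ∀ e ∈ q, e.rows ∉ K
  le_col : ∀ e ∈ q, y ≤ e.col.val
  frame : ∀ e ∈ q, Frame P e.rows e.check (e.col.val + 1)
  closed : ∀ e ∈ q, ClosedUpTo P e.rows.toFinset (insert e.col (closedCols P I)) (e.col.val + 1)

variable {P}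

theorem QueueSpec.nil (I : Finset (Fin n)) (y : ℕ) (K : Finset (List (Fin n))) :
    QueueSpec P I y K [] K := by
  constructor <;> simp

/-- The second part finds only keys absent from `K₁`, which contains all keys of the first part; so
no row-set is queued twice. -/
theorem QueueSpec.append {I : Finset (Fin n)} {y y' : ℕ} {K K₁ K₂ : Finset (List (Fin n))}
    {q₁ q₂ : List (Entry n m)} (h₁ : QueueSpec P I y K q₁ K₁) (h₂ : QueueSpec P I y' K₁ q₂ K₂)
    (hy : y ≤ y') : QueueSpec P I y K (q₁ ++ q₂) K₂ where
  mem_iff G := by rw [h₂.mem_iff, h₁.mem_iff, List.map_append, List.mem_append, or_assoc]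
  nodup := by
    rw [List.map_append, List.nodup_append]
    refine ⟨h₁.nodup, h₂.nodup, ?_⟩
    rintro a ha b hb rfl
    obtain ⟨e, he, rfl⟩ := List.mem_map.1 hb
    exact h₂.fresh e he ((h₁.mem_iff _).2 (Or.inr ha))
  fresh e he := by
    rcases List.mem_append.1 he with he | he
    · exact h₁.fresh e he
    · exact fun h => h₂.fresh e he ((h₁.mem_iff _).2 (Or.inl h))
  le_col e he := by
    rcases List.mem_append.1 he with he | he
    · exact h₁.le_col e he
    · exact hy.trans (h₂.le_col e he)
  frame e he := by
    rcases List.mem_append.1 he with he | he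
    · exact h₁.frame e he
    · exact h₂.frame e he
  closed e he := by
    rcases List.mem_append.1 he with he | he
    · exact h₁.closed e he
    · exact h₂.closed e he

theorem QueueSpec.subset {I : Finset (Fin n)} {y : ℕ} {K K' : Finset (List (Fin n))}
    {q : List (Entry n m)} (h : QueueSpec P I y K q K') : K ⊆ K' :=
  fun G hG => (h.mem_iff G).2 (Or.inl hG)

theorem Frame.length_le {I Γ : List (Fin n)} {y : ℕ} (h : Frame P I Γ y) : I.length ≤ n := by
  have hn : I.Nodup := h.sorted.imp ne_of_lt
  simpa using hn.length_le_card

theorem Frame.check_length_le {I Γ : List (Fin n)} {y : ℕ} (h : Frame P I Γ y) :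
    Γ.length ≤ n := by
  simpa using h.nodup.length_le_card

end Closure

/-! ### One call: testing the runs and looping over the columns -/

section Loop

variable {n m : ℕ} {P : Input n m}

open Classical in
theorem mem_computeRM {w Γ I : List (Fin n)} {j : Fin m} {i : Fin n} :
    i ∈ (computeRM P w j Γ I).val ↔ i ∈ Γ ∨ i ∈ I ∧ i ∉ w ∧
      P.rule.Holds ((w.map fun i => P.A i j).getD (P.minRow - 1) 0 - P.A i j ≤ P.ε)
        (P.A i j - (w.map fun i => P.A i j).reverse.getD (P.minRow - 1) 0 ≤ P.ε) := by
  simp only [computeRM, Timed.val_bind, Timed.val_pure, List.mem_append, List.mem_filter,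
    decide_eq_true_eq]

/-- The rows of a new entry satisfy the invariant of a call. -/
theorem Frame.child {I Γ w G : List (Fin n)} {J : Finset (Fin m)} {y : ℕ} {j : Fin m}
    (hr : 1 ≤ P.minRow) (hF : Frame P I Γ y) (hJ : ClosedUpTo P I.toFinset J j.val)
    (hy : y ≤ j.val) (hI : ¬ Within P.A P.ε I.toFinset j)
    (hws : w.Pairwise (fun a b => P.A a j ≤ P.A b j))
    (hw : IsMaxRun P j I.toFinset w.toFinset) (hG : G = I.filter fun i => decide (i ∈ w))
    (hlen : P.minRow ≤ G.length)
    (hcan : ∀ k : Fin m, k < j → k ∉ J → ¬ Within P.A P.ε G.toFinset k)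
    (hmax : ∀ g ∈ Γ, ∃ k ∈ insert j J, ¬ Within P.A P.ε (insert g G.toFinset) k) :
    Frame P G (computeRM P w j Γ I).val (j.val + 1) ∧
      ClosedUpTo P G.toFinset (insert j (closedCols P I.toFinset)) (j.val + 1) := by
  have hGw : G.toFinset = w.toFinset := by
    ext i
    have : i ∈ w → i ∈ I := fun h => by
      simpa using hw.1 (List.mem_toFinset.2 h)
    simp only [hG, List.mem_toFinset, List.mem_filter, decide_eq_true_eq]
    tauto
  have hGI : G.toFinset ⊆ I.toFinset := hGw ▸ hw.1
  have hGj : Within P.A P.ε G.toFinset j := hGw ▸ hw.2.1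
  have hadd : ∀ x ∈ I, x ∉ G → ¬ Within P.A P.ε (insert x G.toFinset) j := by
    intro x hx hxG
    rw [hGw]
    refine hw.2.2 x (by simpa using hx) ?_
    rw [← hGw]; simpa using hxG
  have hcl : ∀ k, k < j → Within P.A P.ε G.toFinset k → Within P.A P.ε I.toFinset k := by
    intro k hk hGk
    by_contra hIk
    exact hcan k hk (fun h => hIk (hJ.within k h)) hGk
  refine ⟨⟨?_, hlen, ?_, ?_, ?_, ?_, ?_⟩, ?_, ?_⟩
  · rw [hG]; exact hF.sorted.sublist List.filter_sublist
  · intro x hx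
    -- A row of `I` outside `G` is refused by column `j`, since `w` is a maximal run. A row outside
    -- `I` that fits would be in `Γ` by `cover`, where it has been tested.
    by_contra! hcon
    by_cases hxI : x ∈ I
    · exact hadd x hxI (by simpa using hx) (hcon j (by simpa using hGj))
    · have hxΓ : x ∈ Γ := by
        refine hF.cover G.toFinset hGI ?_ x hxI fun k hk => hcon k ?_
        · rw [List.toFinset_card_of_nodup]
          · exact hlen
          · rw [hG]; exact (hF.sorted.imp ne_of_lt).sublist List.filter_sublist
        · rw [mem_closedBelow] at hk
          rw [mem_closedCols]; exact hk.1.mono hGI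
      obtain ⟨k, hk, hk'⟩ := hmax x hxΓ
      refine hk' (hcon k ?_)
      rw [mem_closedCols]
      rcases Finset.mem_insert.1 hk with rfl | hk
      · exact hGj
      · exact (hJ.within k hk).mono hGI
  · intro k hk
    -- If `k ≤ j`, canonicity makes the closed columns of `G` below `k` closed for `I`. A row of `I`
    -- outside `G` exists because column `j` is not closed for `I`, and it fits on all of them.
    by_contra! hlt
    obtain ⟨x, hxI, hxG⟩ : ∃ x ∈ I, x ∉ G := by
      by_contra! h
      exact hI (hGj.mono fun x hx => by simpa using h x (by simpa using hx))
    obtain ⟨k', hk', hk''⟩ := hk x (by simpa using hxG)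
    rw [mem_closedBelow] at hk'
    refine hk'' ((hcl k' (Fin.lt_def.2 (by omega)) hk'.1).mono ?_)
    exact Finset.insert_subset (by simpa using hxI) hGI
  · simp only [computeRM, Timed.val_bind, Timed.val_pure]
    rw [List.nodup_append]
    refine ⟨hF.nodup, (hF.sorted.imp ne_of_lt).sublist List.filter_sublist, ?_⟩
    rintro a ha b hb rfl
    exact hF.disjoint a ha (List.mem_filter.1 hb).1
  · intro g hg hgG
    rw [mem_computeRM] at hg
    have hgI : g ∈ I := by simpa using hGI (List.mem_toFinset.2 hgG)
    rcases hg with hg | hg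
    · exact hF.disjoint g hg hgI
    · refine hg.2.1 ?_
      have : g ∈ w.toFinset := hGw ▸ List.mem_toFinset.2 hgG
      simpa using this
  · intro G' hG' hc x hx hcov
    rw [mem_computeRM]
    -- A row of `I` outside `G` passes the pivot test of column `j`; a row outside `I` was already
    -- in `Γ`, because the closed columns of `I` below `y` remain closed for `G`.
    by_cases hxI : x ∈ I
    · refine Or.inr ⟨hxI, fun hxw => hx ?_,
        PivotRule.holds_of_and (pivot_le P hws (M := G') ?_ hr hc ?_) _⟩
      · have : x ∈ G.toFinset := hGw ▸ List.mem_toFinset.2 hxw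
        simpa using this
      · intro a ha
        have := hG' ha
        rw [hGw] at this
        simpa using this
      · exact hcov j (by simpa using hGj)
    · refine Or.inl (hF.cover G' (hG'.trans hGI) hc x hxI fun k hk => hcov k ?_)
      rw [mem_closedBelow] at hk ⊢
      exact ⟨hk.1.mono hGI, by omega⟩
  · intro k hk
    rcases Finset.mem_insert.1 hk with rfl | hk
    · exact hGj
    · exact (mem_closedCols.1 hk).mono hGI
  · intro k hk hGk
    rw [Finset.mem_insert, mem_closedCols]
    by_cases h : k = j
    · exact Or.inl h
    · refine Or.inr (hcl k (lt_of_le_of_ne (Fin.le_def.2 (by omega)) h) hGk)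

variable {σ : Type} {S : SymbolTable (List (Fin n)) σ} (T : TableSpec S)

/-- The effect of a part of the loop over the attributes: `t` and `t'` are the symbol tables
before and after it, `q` is what it adds to the queue. -/
structure LoopSpec (I : Finset (Fin n)) (y : ℕ) (K : Finset (List (Fin n))) (t : σ)
    (q : List (Entry n m)) (t' : σ) (K' : Finset (List (Fin n))) : Prop where
  rep : T.Rep t' K'
  queue : QueueSpec P I y K q K'
  cost : T.cost t ≤ T.cost t'

/-- A descendant passes the size, canonicity and row-maximality tests, so it can only be rejected
for being in the table already. A queued row-set need not be a descendant: `J` may contain inherited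
columns beyond `j`, which the row-maximality test also uses. -/
theorem candidate_spec (hr : 1 ≤ P.minRow) {I Γ w : List (Fin n)} {J : Finset (Fin m)} {y : ℕ}
    {j : Fin m} (hF : Frame P I Γ y) (hJ : ClosedUpTo P I.toFinset J j.val)
    (hy : y ≤ j.val) (hI : ¬ Within P.A P.ε I.toFinset j)
    (hwn : w.Nodup) (hw0 : w ≠ []) (hws : w.Pairwise (fun a b => P.A a j ≤ P.A b j))
    (hw : IsMaxRun P j I.toFinset w.toFinset) {t : σ} {K : Finset (List (Fin n))}
    (hK : T.Rep t K) :
    ∃ K', LoopSpec (P := P) T I.toFinset j.val K t (candidate P S I Γ J j w t).val.1.toList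
        (candidate P S I Γ J j w t).val.2 K' ∧
      (IsDescendant P I.toFinset j w.toFinset → ∃ G ∈ K', G.toFinset = w.toFinset) := by
  obtain ⟨G, hG⟩ : ∃ G, G = I.filter fun i => decide (i ∈ w) := ⟨_, rfl⟩
  have hGw : G.toFinset = w.toFinset := by
    ext i
    have : i ∈ w → i ∈ I := fun h => by
      simpa using hw.1 (List.mem_toFinset.2 h)
    simp only [hG, List.mem_toFinset, List.mem_filter, decide_eq_true_eq]
    tauto
  have hGn : G.Nodup := by rw [hG]; exact (hF.sorted.imp ne_of_lt).sublist List.filter_sublist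
  have hlen : G.length = w.length := by
    rw [← List.toFinset_card_of_nodup hGn, ← List.toFinset_card_of_nodup hwn, hGw]
  have hG0 : G ≠ [] := by
    rw [← List.length_pos_iff, hlen, List.length_pos_iff]; exact hw0
  have hasc : (ascending w I).val = G := by simp [ascending, hG]
  have hstay : LoopSpec (P := P) T I.toFinset j.val K t [] t K := ⟨hK, .nil _ _ _, le_rfl⟩
  simp only [candidate, Timed.val_bind, Timed.val_ite, Timed.val_pure, hasc, Bool.not_eq_true']
  split_ifs with h₁ h₂ h₃ h₄
  · refine ⟨K, hstay, fun hD => ?_⟩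
    have := hD.minRow_le
    rw [List.toFinset_card_of_nodup hwn] at this
    omega
  · exact ⟨K, hstay, fun _ => ⟨G, (T.search_val hK G).1 h₂, hGw⟩⟩
  · refine ⟨K, hstay, fun hD => ?_⟩
    have h₃' := (isCanonical_val P hG0 J ((List.finRange m).take j)).2 (by
      intro k hk hkJ hGk
      have hkj : k < j := by
        rw [List.mem_take_iff_getElem] at hk
        obtain ⟨i, hi, rfl⟩ := hk
        rw [List.getElem_finRange, Fin.lt_def]
        simp
        omega
      rw [hGw] at hGk
      exact hkJ (hJ.mem k hkj (hD.canonical k hkj hGk)))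
    rw [h₃'] at h₃
    simp at h₃
  · refine ⟨K, hstay, fun hD => ?_⟩
    have h₄' := (isRowMaximal_val P hG0 (insert j J) Γ).2 (by
      intro g hg
      have hgw : g ∉ w.toFinset := fun h => hF.disjoint g hg (by simpa using hw.1 h)
      -- The column refusing `g` is `j` or a smaller one; in the latter case canonicity makes it
      -- closed for `I`, hence a member of `J`.
      obtain ⟨k, hk, hk'⟩ := hD.rowMaximal g hgw
      refine ⟨k, ?_, by rwa [hGw]⟩
      rw [mem_closedBelow] at hk
      rw [Finset.mem_insert]
      by_cases h : k = j
      · exact Or.inl h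
      · have hkj : k < j := lt_of_le_of_ne (Fin.le_def.2 (by omega)) h
        exact Or.inr (hJ.mem k hkj (hD.canonical k hkj hk.1)))
    rw [h₄'] at h₄
    simp at h₄
  · have hGK : G ∉ K := fun h => h₂ ((T.search_val hK G).2 h)
    rw [Bool.not_eq_false] at h₃ h₄
    obtain ⟨c₁, c₂⟩ := hF.child hr hJ hy hI hws hw hG (by omega) (by
      intro k hk
      refine (isCanonical_val P hG0 J ((List.finRange m).take j)).1 h₃ k ?_
      rw [List.mem_take_iff_getElem]
      exact ⟨k.val, by simpa using Fin.lt_def.1 hk, by simp⟩)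
      ((isRowMaximal_val P hG0 (insert j J) Γ).1 h₄)
    refine ⟨insert G K, ⟨T.rep_insert hK G hGK, ?_, T.cost_mono hK G hGK⟩,
      fun _ => ⟨G, by simp, hGw⟩⟩
    constructor
    · intro G'
      simp [or_comm]
    · simp
    · simpa using hGK
    · simp
    · simpa using c₁
    · simpa using c₂

/-- Apart from one search and one insertion, the steps sum to at most `3 * n * m + 3 * m + 11 * n +
2`, whence 19. -/
theorem candidate_time {I Γ w : List (Fin n)} {J : Finset (Fin m)} {y : ℕ} {j : Fin m}
    (hF : Frame P I Γ y) (hwn : w.length ≤ n) (hw0 : w ≠ []) {t : σ}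
    {K : Finset (List (Fin n))} (hK : T.Rep t K) :
    (candidate P S I Γ J j w t).time ≤ 19 * (n * m) + 2 * T.cost t := by
  obtain ⟨G, hG⟩ : ∃ G, G = (ascending w I).val := ⟨_, rfl⟩
  have hI := hF.length_le
  have hΓ := hF.check_length_le
  have hGl : G.length ≤ n := by
    rw [hG]; exact (List.length_filter_le _ _).trans hI
  have hj := j.isLt
  have hn : 1 ≤ n := (List.length_pos_iff.2 hw0).trans_le hwn
  have h₁ := T.search_time hK G hGl
  have h₂ := T.insert_time hK G hGl
  have h₃ := isCanonical_time P G J ((List.finRange m).take j)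
  have h₄ := isRowMaximal_time P G (insert j J) Γ
  have h₅ : ((List.finRange m).take j).length ≤ m := by simp
  have h₆ : (isCanonical P G J ((List.finRange m).take j)).time ≤ m * (n + 1) :=
    h₃.trans (Nat.mul_le_mul h₅ (by omega))
  have h₇ : (isRowMaximal P G (insert j J) Γ).time ≤ m * (n + 1) + n * (m + 1) :=
    h₄.trans (Nat.add_le_add (Nat.mul_le_mul_left _ (by omega)) (Nat.mul_le_mul_right _ hΓ))
  have hnm : n ≤ n * m := Nat.le_mul_of_pos_right n (by omega)
  have hmn : m ≤ n * m := Nat.le_mul_of_pos_left m hn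
  rw [mul_add, mul_comm m n] at h₆ h₇
  rw [mul_add] at h₇
  simp only [candidate, Timed.time_bind, Timed.time_ite, Timed.time_pure, Timed.time_charge,
    Timed.time_tick, ← hG]
  have ha : (ascending w I).time = n + w.length + I.length := rfl
  have hc : (computeRM P w j Γ I).time = n + 3 * w.length + I.length + Γ.length := rfl
  rw [ha, hc]
  split_ifs <;> omega

theorem candidates_spec (hr : 1 ≤ P.minRow) {I Γ : List (Fin n)} {J : Finset (Fin m)} {y : ℕ}
    {j : Fin m} (hF : Frame P I Γ y) (hJ : ClosedUpTo P I.toFinset J j.val)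
    (hy : y ≤ j.val) (hI : ¬ Within P.A P.ε I.toFinset j) :
    ∀ (ws : List (List (Fin n))) {t : σ} {K : Finset (List (Fin n))}, T.Rep t K →
    (∀ w ∈ ws, w.Nodup ∧ w ≠ [] ∧ w.Pairwise (fun a b => P.A a j ≤ P.A b j) ∧
      IsMaxRun P j I.toFinset w.toFinset) →
    ∃ K', LoopSpec (P := P) T I.toFinset j.val K t (candidates P S I Γ J j ws t).val.1
        (candidates P S I Γ J j ws t).val.2 K' ∧
      (∀ w ∈ ws, IsDescendant P I.toFinset j w.toFinset → ∃ G ∈ K', G.toFinset = w.toFinset) ∧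
      (candidates P S I Γ J j ws t).time ≤ ws.length *
        (19 * (n * m) + 2 * T.cost (candidates P S I Γ J j ws t).val.2)
  | [], t, K, hK, _ => ⟨K, ⟨hK, .nil _ _ _, le_rfl⟩, by simp, by simp [candidates]⟩
  | w :: ws, t, K, hK, h => by
      obtain ⟨hwn, hw0, hws, hw⟩ := h w (by simp)
      obtain ⟨K₁, hL₁, hD₁⟩ := candidate_spec T hr hF hJ hy hI hwn hw0 hws hw hK
      have ht := candidate_time T (J := J) (j := j) hF
        (by simpa using hwn.length_le_card) hw0 hK
      obtain ⟨K₂, hL₂, hD₂, ht₂⟩ := candidates_spec hr hF hJ hy hI ws hL₁.rep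
        fun w' hw' => h w' (by simp [hw'])
      have hc := hL₂.cost
      have hc₁ := hL₁.cost
      refine ⟨K₂, ⟨hL₂.rep, hL₁.queue.append hL₂.queue le_rfl, hc₁.trans hc⟩, ?_, ?_⟩
      · intro w' hw' hD
        rcases List.mem_cons.1 hw' with rfl | hw'
        · obtain ⟨G, hG, e⟩ := hD₁ hD
          exact ⟨G, hL₂.queue.subset hG, e⟩
        · exact hD₂ w' hw' hD
      · simp only [candidates, Timed.time_bind, Timed.val_bind, Timed.val_pure, Timed.time_pure,
          List.length_cons, add_mul, one_mul]
        omega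

/-- Each column leaves `J` closed one column further, and a column that is not closed for `I` is
sorted and all its maximal runs are tested. Table operations are charged at the cost of the final
table, so that one bound serves all columns. -/
theorem closeColumns_spec (hε : 0 ≤ P.ε) (hr : 1 ≤ P.minRow) {I Γ : List (Fin n)} {y : ℕ}
    (hF : Frame P I Γ y) : ∀ (d p : ℕ), m - p = d → y ≤ p → ∀ {J : Finset (Fin m)} {t : σ}
    {K : Finset (List (Fin n))}, ClosedUpTo P I.toFinset J p → T.Rep t K →
    (closeColumns P S I Γ ((List.finRange m).drop p) J t).val.1 = closedCols P I.toFinset ∧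
    ∃ K', LoopSpec (P := P) T I.toFinset p K t
        (closeColumns P S I Γ ((List.finRange m).drop p) J t).val.2.1
        (closeColumns P S I Γ ((List.finRange m).drop p) J t).val.2.2 K' ∧
      (∀ (k : Fin m) (M : Finset (Fin n)), p ≤ k.val → ¬ Within P.A P.ε I.toFinset k →
        IsDescendant P I.toFinset k M → ∃ G ∈ K', G.toFinset = M) ∧
      (closeColumns P S I Γ ((List.finRange m).drop p) J t).time ≤ d * (27 * (n ^ 2 * m) +
        2 * (n * T.cost (closeColumns P S I Γ ((List.finRange m).drop p) J t).val.2.2)) := by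
  intro d
  induction d with
  | zero =>
    intro p hd hy J t K hJ hK
    have hmp : m ≤ p := by omega
    have hnil : (List.finRange m).drop p = [] := List.drop_eq_nil_of_le (by simpa using hmp)
    rw [hnil]
    refine ⟨?_, K, ⟨hK, .nil _ _ _, le_rfl⟩, ?_, by simp [closeColumns]⟩
    · ext k
      simp only [closeColumns, Timed.val_pure, mem_closedCols]
      exact ⟨hJ.within k, hJ.mem k (k.isLt.trans_le hmp)⟩
    · intro k M hk
      exact absurd k.isLt (by omega)
  | succ d ih =>
    intro p hd hy J t K hJ hK
    have hpm : p < m := by omega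
    obtain ⟨j, hj⟩ : ∃ j : Fin m, j.val = p := ⟨⟨p, hpm⟩, rfl⟩
    have hcons : (List.finRange m).drop p = j :: (List.finRange m).drop (p + 1) := by
      rw [List.drop_eq_getElem_cons (by simpa using hpm)]
      congr 1
      ext; simp [hj]
    subst hj
    have hI0 : I ≠ [] := by
      rw [← List.length_pos_iff]; exact hr.trans hF.minRow_le
    have hIn := hF.length_le
    have hn : 1 ≤ n := (List.length_pos_iff.2 hI0).trans_le hIn
    have hnn : n ^ 2 ≤ n ^ 2 * m := Nat.le_mul_of_pos_right _ (by omega)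
    have hn1 : n ≤ n ^ 2 := Nat.le_self_pow two_ne_zero n
    have hext := extrema_time (fun i => P.A i j) I
    have he : (extrema (fun i => P.A i j) I).val.1 - (extrema (fun i => P.A i j) I).val.2 ≤ P.ε ↔
        Within P.A P.ε I.toFinset j := by
      rw [extrema_sub_le_iff _ hI0]; simp [Within]
    rw [hcons]
    by_cases hjJ : j ∈ J
    · have hJ' : ClosedUpTo P I.toFinset J (j.val + 1) := ⟨hJ.within, fun k hk hw => by
        by_cases e : k = j
        · exact e ▸ hjJ
        · exact hJ.mem k (by have := Fin.val_ne_of_ne e; omega) hw⟩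
      obtain ⟨h₁, K', hL, hD, ht⟩ := ih (j.val + 1) (by omega) (by omega) hJ' hK
      simp only [closeColumns, Timed.val_bind, Timed.time_bind, hjJ, if_true, Timed.time_tick]
      refine ⟨h₁, K', ⟨hL.rep, (QueueSpec.nil _ _ _).append hL.queue (by omega), hL.cost⟩, ?_, ?_⟩
      · intro k M hk hkw hDk
        refine hD k M ?_ hkw hDk
        have : k ≠ j := fun e => hkw (e ▸ hJ.within j hjJ)
        have := Fin.val_ne_of_ne this
        omega
      · rw [add_mul, one_mul]
        omega
    · by_cases hw : Within P.A P.ε I.toFinset j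
      · have hJ' : ClosedUpTo P I.toFinset (insert j J) (j.val + 1) := by
          refine ⟨fun k hk => ?_, fun k hk hkw => ?_⟩
          · rcases Finset.mem_insert.1 hk with rfl | hk
            · exact hw
            · exact hJ.within k hk
          · rw [Finset.mem_insert]
            by_cases e : k = j
            · exact Or.inl e
            · exact Or.inr (hJ.mem k (by have := Fin.val_ne_of_ne e; omega) hkw)
        obtain ⟨h₁, K', hL, hD, ht⟩ := ih (j.val + 1) (by omega) (by omega) hJ' hK
        simp only [closeColumns, Timed.val_bind, Timed.time_bind, hjJ, if_false, he.2 hw, if_true,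
          Timed.time_tick]
        refine ⟨h₁, K', ⟨hL.rep, (QueueSpec.nil _ _ _).append hL.queue (by omega), hL.cost⟩,
          ?_, ?_⟩
        · intro k M hk hkw hDk
          refine hD k M ?_ hkw hDk
          have : k ≠ j := fun e => hkw (e ▸ hw)
          have := Fin.val_ne_of_ne this
          omega
        · rw [add_mul, one_mul]
          omega
      · obtain ⟨L, hLs⟩ : ∃ L, L = (mergeSort (fun i => P.A i j) I).val := ⟨_, rfl⟩
        have hperm : L.Perm I := hLs ▸ mergeSort_perm _ I
        have hsort : L.Pairwise fun a b => P.A a j ≤ P.A b j :=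
          hLs ▸ mergeSort_sorted (fun i => P.A i j) I
        have hnodup : L.Nodup := hperm.nodup_iff.2 (hF.sorted.imp ne_of_lt)
        have hLI : L.toFinset = I.toFinset := List.toFinset_eq_of_perm _ _ hperm
        have hLl : L.length = I.length := hperm.length_eq
        have hws : ∀ w ∈ (newRowSets P j 0 L).val, w.Nodup ∧ w ≠ [] ∧
            w.Pairwise (fun a b => P.A a j ≤ P.A b j) ∧
            IsMaxRun P j I.toFinset w.toFinset := by
          intro w hw
          obtain ⟨c₁, c₂, c₃⟩ := newRowSets_sound P j hε [] L 0 (by simpa using hsort) (by simp) w hw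
          exact ⟨hnodup.sublist c₁, c₂, hsort.sublist c₁, by simpa [hLI] using c₃⟩
        obtain ⟨K₁, hL₁, hD₁, ht₁⟩ := candidates_spec T hr hF hJ hy hw _ hK hws
        have hJ' : ClosedUpTo P I.toFinset J (j.val + 1) := ⟨hJ.within, fun k hk hkw => by
          by_cases e : k = j
          · exact absurd (e ▸ hkw) hw
          · exact hJ.mem k (by have := Fin.val_ne_of_ne e; omega) hkw⟩
        obtain ⟨h₁, K', hL, hD, ht⟩ := ih (j.val + 1) (by omega) (by omega) hJ' hL₁.rep
        simp only [closeColumns, Timed.val_bind, Timed.time_bind, hjJ, if_false, mt he.1 hw,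
          Timed.time_tick, Timed.val_pure, Timed.time_pure, ← hLs]
        refine ⟨h₁, K', ⟨hL.rep, hL₁.queue.append hL.queue (by omega),
          hL₁.cost.trans hL.cost⟩, ?_, ?_⟩
        · intro k M hk hkw hDk
          by_cases e : k = j
          · subst e
            have hM : M.Nonempty := Finset.card_pos.1 (hr.trans hDk.minRow_le)
            obtain ⟨w, hw, rfl⟩ := newRowSets_complete P k hε hM [] L 0 (by simpa using hsort)
              (by simpa using hnodup) (Or.inl rfl) (by simpa [hLI] using hDk.isMaxRun)
              (fun a ha => by
                have := hDk.isMaxRun.1 ha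
                rw [← hLI] at this
                simpa using this)
            obtain ⟨G, hG, e⟩ := hD₁ w hw hDk
            exact ⟨G, hL.queue.subset hG, e⟩
          · refine hD k M ?_ hkw hDk
            have := Fin.val_ne_of_ne e
            omega
        · have t₁ := mergeSort_time (fun i => P.A i j) I
          have t₂ := newRowSets_time P j 0 L
          have t₃ := newRowSets_length_le P j 0 L
          have t₄ : I.length ^ 2 ≤ n ^ 2 := Nat.pow_le_pow_left hIn 2
          have t₅ : L.length * (2 * L.length + 1) ≤ n * (2 * n + 1) :=
            Nat.mul_le_mul (by omega) (by omega)
          have hc := hL.cost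
          have t₆ := ht₁.trans (Nat.mul_le_mul (show _ ≤ n by omega)
            (Nat.add_le_add_left (Nat.mul_le_mul_left 2 hc) _))
          have e₁ : n * (2 * n + 1) = 2 * n ^ 2 + n := by ring
          have e₂ : ∀ c, n * (19 * (n * m) + 2 * c) = 19 * (n ^ 2 * m) + 2 * (n * c) := by
            intro c; ring
          rw [e₁] at t₅
          rw [e₂] at t₆
          rw [add_mul, one_mul]
          omega

end Loop

section Recursion

variable {n m : ℕ}

/-- An upper bound for the time spent on one bicluster, when an operation on the symbol table takes
at most `D` steps. -/
def nodeCost (n m D : ℕ) : ℕ := m * (27 * (n ^ 2 * m) + 2 * (n * D)) + (n + m) + (m + 1) + 1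

/-! ### Delays -/

/-- The enumeration times of `s` have gaps at most `b`, and at most `w` steps have been spent since
the last of them. -/
def HasDelay {σ : Type} (b w : ℕ) (s : Run n m σ) : Prop :=
  ∃ l a, 0 :: s.out.map Prod.fst = l ++ [a] ∧
    List.IsChain (fun x y => x ≤ y ∧ y ≤ x + b) (l ++ [a]) ∧ a ≤ s.clock ∧ s.clock ≤ a + w

theorem HasDelay.mono {σ : Type} {b w w' : ℕ} {s : Run n m σ} (h : HasDelay b w s)
    (hw : w ≤ w') : HasDelay b w' s := by
  obtain ⟨l, a, h₁, h₂, h₃, h₄⟩ := h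
  exact ⟨l, a, h₁, h₂, h₃, by omega⟩

theorem HasDelay.wait {σ : Type} {b w : ℕ} {s : Run n m σ} (h : HasDelay b w s) (k : ℕ) :
    HasDelay b (w + k) (s.wait k) := by
  obtain ⟨l, a, h₁, h₂, h₃, h₄⟩ := h
  refine ⟨l, a, h₁, h₂, ?_, ?_⟩ <;> simp only [Run.wait] <;> omega

theorem HasDelay.isChain {σ : Type} {b w t : ℕ} {s : Run n m σ} (h : HasDelay b w s)
    (ht : s.clock ≤ t) (hb : t + w ≤ s.clock + b) :
    ∃ a l, 0 :: s.out.map Prod.fst = l ++ [a] ∧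
      List.IsChain (fun x y => x ≤ y ∧ y ≤ x + b) ((l ++ [a]) ++ [t]) := by
  obtain ⟨l, a, h₁, h₂, h₃, h₄⟩ := h
  refine ⟨a, l, h₁, ?_⟩
  rw [List.append_assoc, List.singleton_append, List.isChain_split]
  exact ⟨h₂, List.isChain_pair.2 ⟨by omega, by omega⟩⟩

theorem HasDelay.output {σ : Type} {b w c : ℕ} {s : Run n m σ} (h : HasDelay b w s)
    (hb : c + w ≤ b) (tab : σ) (B : Bicluster n m) :
    HasDelay b 0 (⟨s.clock + c, tab, s.out ++ [(s.clock + c, B)]⟩ : Run n m σ) := by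
  obtain ⟨a, l, h₁, h₂⟩ := h.isChain (t := s.clock + c) (by omega) (by omega)
  refine ⟨l ++ [a], s.clock + c, ?_, h₂, le_rfl, le_rfl⟩
  rw [List.map_append, ← List.cons_append, h₁]
  rfl

/-! ### The recursion -/

variable {P : Input n m} {σ : Type} {S : SymbolTable (List (Fin n)) σ} (T : TableSpec S)

variable (P) in
/-- All descendants of the rows `G` are among the keys `K`. -/
def Expanded (y : ℕ) (K : Finset (List (Fin n))) (G : List (Fin n)) : Prop :=
  ∃ Γ y', y ≤ y' ∧ Frame P G Γ y' ∧ ∀ (k : Fin m) (M : Finset (Fin n)), y' ≤ k.val →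
    ¬ Within P.A P.ε G.toFinset k → IsDescendant P G.toFinset k M → ∃ G' ∈ K, G'.toFinset = M

theorem Expanded.mono {y y' : ℕ} {K K' : Finset (List (Fin n))} {G : List (Fin n)}
    (h : Expanded P y K G) (hy : y' ≤ y) (hK : K ⊆ K') : Expanded P y' K' G := by
  obtain ⟨Γ, z, h₁, h₂, h₃⟩ := h
  refine ⟨Γ, z, hy.trans h₁, h₂, fun k M hk hw hD => ?_⟩
  obtain ⟨G', hG', e⟩ := h₃ k M hk hw hD
  exact ⟨G', hK hG', e⟩

/-- The effect of processing the row-sets `Q` and all their descendants: `rows` are the row-sets of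
the new biclusters. -/
structure Traversal (y : ℕ) (Q : List (List (Fin n))) (K : Finset (List (Fin n)))
    (s : Run n m σ) (rows : List (List (Fin n))) (s' : Run n m σ)
    (K' : Finset (List (Fin n))) : Prop where
  rep : T.Rep s'.table K'
  subset : K ⊆ K'
  cost : T.cost s.table ≤ T.cost s'.table
  biclusters : s'.biclusters =
    s.biclusters ++ rows.map fun G => (G.toFinset, closedCols P G.toFinset)
  nodup : rows.Nodup
  mem_iff : ∀ G, G ∈ rows ↔ G ∈ Q ∨ (G ∈ K' ∧ G ∉ K)
  expanded : ∀ G ∈ rows, Expanded P y K' G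

/-- The whole queue is in the table before its first entry is processed, so the traversal below `G₀`
cannot rediscover `G₀` or a member of `Q`. -/
theorem Traversal.append {y : ℕ} {G₀ : List (Fin n)} {Q : List (List (Fin n))}
    {K K₁ K₂ : Finset (List (Fin n))} {s s₁ s₂ : Run n m σ} {r₁ r₂ : List (List (Fin n))}
    (h₁ : Traversal (P := P) T y [G₀] K s r₁ s₁ K₁) (h₂ : Traversal (P := P) T y Q K₁ s₁ r₂ s₂ K₂)
    (hG₀ : G₀ ∈ K) (hQ : ∀ G ∈ Q, G ∈ K) (hn : G₀ ∉ Q) :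
    Traversal (P := P) T y (G₀ :: Q) K s (r₁ ++ r₂) s₂ K₂ where
  rep := h₂.rep
  subset := h₁.subset.trans h₂.subset
  cost := h₁.cost.trans h₂.cost
  biclusters := by rw [h₂.biclusters, h₁.biclusters, List.map_append, List.append_assoc]
  nodup := by
    rw [List.nodup_append]
    refine ⟨h₁.nodup, h₂.nodup, ?_⟩
    rintro G hG _ hG' rfl
    rw [h₁.mem_iff, List.mem_singleton] at hG
    rw [h₂.mem_iff] at hG'
    rcases hG with rfl | ⟨hG, hGK⟩ <;> rcases hG' with hG' | ⟨-, hG'⟩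
    · exact hn hG'
    · exact hG' (h₁.subset hG₀)
    · exact hGK (hQ G hG')
    · exact hG' hG
  mem_iff G := by
    rw [List.mem_append, h₁.mem_iff, h₂.mem_iff, List.mem_singleton, List.mem_cons]
    have hs₁ : G ∈ K → G ∈ K₁ := fun h => h₁.subset h
    have hs₂ : G ∈ K₁ → G ∈ K₂ := fun h => h₂.subset h
    tauto
  expanded G hG := by
    rcases List.mem_append.1 hG with hG | hG
    · exact (h₁.expanded G hG).mono le_rfl h₂.subset
    · exact h₂.expanded G hG

/-- The time bounds for processing row-sets from attribute `y` on; `w` and `w'` are the numbers of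
steps since the last output before and after it, and `c` steps are not accounted for. -/
structure TimeBounds (s : Run n m σ) (q : ℕ) (s' : Run n m σ) (c w w' : ℕ) : Prop where
  total : ∀ D, T.cost s'.table ≤ D → s'.clock + c ≤ s.clock + q * nodeCost n m D
  delay : ∀ D b, T.cost s'.table ≤ D → nodeCost n m D + (n + 2 * m + 1) ≤ b →
    HasDelay b w s → HasDelay b w' s'

/-- Induction on the number of remaining columns, with an inner induction on the queue. The row-sets
output are `I` and exactly the keys inserted during the call, each once, so time can be charged to
outputs. -/
theorem computeBiclustersFrom_spec (hε : 0 ≤ P.ε) (hr : 1 ≤ P.minRow) :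
    ∀ (d y : ℕ), m - y = d → ∀ {I Γ : List (Fin n)} {J : Finset (Fin m)} {s : Run n m σ}
      {K : Finset (List (Fin n))}, Frame P I Γ y → ClosedUpTo P I.toFinset J y →
      T.Rep s.table K → (I ∈ K ∨ I.toFinset = Finset.univ) →
      ∃ rows K', Traversal (P := P) T y [I] K s rows (computeBiclustersFrom P S I J y Γ s) K' ∧
        TimeBounds T s rows.length (computeBiclustersFrom P S I J y Γ s) (m + 1) (n + 2 * m + 1)
          (m - y + 1) := by
  intro d
  induction d using Nat.strong_induction_on with
  | _ d ih =>
  intro y hd I Γ J s K hF hJ hK hroot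
  obtain ⟨hcl, K₁, hL, hD, ht⟩ :=
    closeColumns_spec T hε hr hF d y hd le_rfl hJ hK
  have queue : ∀ (q : List (Entry n m)), (∀ e ∈ q, y ≤ e.col.val) →
      (∀ e ∈ q, Frame P e.rows e.check (e.col.val + 1)) →
      (∀ e ∈ q, ClosedUpTo P e.rows.toFinset
        (insert e.col (closedCols P I.toFinset)) (e.col.val + 1)) →
      (q.map Entry.rows).Nodup → ∀ (s : Run n m σ) (K : Finset (List (Fin n))),
      (∀ e ∈ q, e.rows ∈ K) → T.Rep s.table K →
      ∃ rows K', Traversal (P := P) T (y + 1) (q.map Entry.rows) K s rows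
          (q.foldl (fun s e => if _h : y ≤ e.col then
            computeBiclustersFrom P S e.rows (insert e.col (closedCols P I.toFinset)) (e.col + 1)
              e.check (s.wait (m + 1)) else s) s) K' ∧
        TimeBounds T s rows.length (q.foldl (fun s e => if _h : y ≤ e.col then
            computeBiclustersFrom P S e.rows (insert e.col (closedCols P I.toFinset)) (e.col + 1)
              e.check (s.wait (m + 1)) else s) s) 0 (m - y) (m - y) := by
    intro q
    induction q with
    | nil =>
      intro _ _ _ _ s K _ hK
      refine ⟨[], K, ⟨hK, subset_rfl, le_rfl, by simp, by simp, by simp, by simp⟩, ?_, ?_⟩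
      · simp
      · exact fun _ _ _ _ h => h
    | cons e q ihq =>
      intro hy hf hc hn s K hmem hK
      rw [List.foldl_cons]
      have hye := hy e (by simp)
      have hem := e.col.isLt
      rw [dif_pos hye]
      obtain ⟨r₁, K₁, hT₁, hB₁⟩ := ih (m - (e.col.val + 1)) (by omega) (e.col.val + 1) rfl
        (s := s.wait (m + 1)) (hf e (by simp)) (hc e (by simp)) hK
        (Or.inl (hmem e (by simp)))
      obtain ⟨r₂, K₂, hT₂, hB₂⟩ := ihq (fun e' he' => hy e' (by simp [he']))
        (fun e' he' => hf e' (by simp [he'])) (fun e' he' => hc e' (by simp [he']))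
        (List.nodup_cons.1 hn).2 _ K₁
        (fun e' he' => hT₁.subset (hmem e' (by simp [he']))) hT₁.rep
      have hT₁' : Traversal (P := P) T (y + 1) [e.rows] K s r₁ _ K₁ :=
        ⟨hT₁.rep, hT₁.subset, hT₁.cost, hT₁.biclusters, hT₁.nodup, hT₁.mem_iff,
          fun G hG => (hT₁.expanded G hG).mono (by omega) subset_rfl⟩
      refine ⟨r₁ ++ r₂, K₂, hT₁'.append T hT₂ (hmem e (by simp)) ?_ (List.nodup_cons.1 hn).1,
        ?_, ?_⟩
      · intro G hG
        obtain ⟨e', he', rfl⟩ := List.mem_map.1 hG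
        exact hmem e' (by simp [he'])
      · intro D hD
        have h₁ := hB₁.total D (hT₂.cost.trans hD)
        have h₂ := hB₂.total D hD
        have hw : (s.wait (m + 1)).clock = s.clock + (m + 1) := rfl
        rw [hw] at h₁
        rw [List.length_append, add_mul]
        omega
      · intro D b hD hb hs
        refine hB₂.delay D b hD hb ?_
        -- The child starts at a column greater than `y`, so returning from it leaves at most `m -
        -- y` idle steps; passing to a child costs `m + 1` more.
        refine (hB₁.delay D b (hT₂.cost.trans hD) hb ?_).mono (by omega)
        exact (hs.wait (m + 1)).mono (by omega)
  rw [computeBiclustersFrom]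
  obtain ⟨c, hc⟩ : ∃ c, c = closeColumns P S I Γ ((List.finRange m).drop y) J s.table := ⟨_, rfl⟩
  rw [← hc] at hcl hL ht
  rw [← hc]
  simp only [hcl]
  obtain ⟨rows, K', hT, hB⟩ := queue c.val.2.1 hL.queue.le_col hL.queue.frame hL.queue.closed
    hL.queue.nodup
    ⟨s.clock + c.time + (I.length + m), c.val.2.2,
      s.out ++ [(s.clock + c.time + (I.length + m), I.toFinset, closedCols P I.toFinset)]⟩ K₁
    (fun e he => (hL.queue.mem_iff _).2 (Or.inr (List.mem_map_of_mem he))) hL.rep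
  -- A row-set already in the table is never new. The root `X` is not put into the table, but it is
  -- row-maximal with no columns at all, so by `least` no call starting beyond the first column can
  -- have it as its row-set.
  have hI : I ∉ rows := by
    intro hI
    rcases hroot with hIK | hI'
    · rcases (hT.mem_iff I).1 hI with h | ⟨-, h⟩
      · obtain ⟨e, he, hIe⟩ := List.mem_map.1 h
        exact hL.queue.fresh e he (hIe ▸ hIK)
      · exact h (hL.queue.subset hIK)
    · obtain ⟨Γ', y', h₁, h₂, -⟩ := hT.expanded I hI
      have := h₂.least 0 fun x hx => by simp [hI'] at hx
      omega
  have hIn := hF.length_le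
  have hcost : ∀ D, T.cost c.val.2.2 ≤ D → c.time + (I.length + m) + 1 + (m + 1) ≤
      nodeCost n m D := by
    intro D hD
    have h₁ : d * (27 * (n ^ 2 * m) + 2 * (n * T.cost c.val.2.2)) ≤
        m * (27 * (n ^ 2 * m) + 2 * (n * D)) :=
      Nat.mul_le_mul (by omega)
        (Nat.add_le_add_left (Nat.mul_le_mul_left 2 (Nat.mul_le_mul_left n hD)) _)
    unfold nodeCost
    omega
  refine ⟨I :: rows, K', ⟨hT.rep, hL.queue.subset.trans hT.subset, hL.cost.trans hT.cost, ?_,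
    List.nodup_cons.2 ⟨hI, hT.nodup⟩, ?_, ?_⟩, ?_, ?_⟩
  · refine hT.biclusters.trans ?_
    simp [Run.biclusters]
  · intro G
    rw [List.mem_cons, hT.mem_iff, List.mem_singleton, hL.queue.mem_iff]
    have h₁ : G ∈ c.val.2.1.map Entry.rows → G ∉ K := fun h => by
      obtain ⟨e, he, rfl⟩ := List.mem_map.1 h
      exact hL.queue.fresh e he
    have h₂ : G ∈ c.val.2.1.map Entry.rows → G ∈ K' := fun h =>
      hT.subset ((hL.queue.mem_iff _).2 (Or.inr h))
    tauto
  · intro G hG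
    rcases List.mem_cons.1 hG with rfl | hG
    · refine ⟨Γ, y, le_rfl, hF, fun k M hk hw hDk => ?_⟩
      obtain ⟨G', hG', e⟩ := hD k M hk hw hDk
      exact ⟨G', hT.subset hG', e⟩
    · exact (hT.expanded G hG).mono (by omega) subset_rfl
  · intro D hcD
    have h₁ := hB.total D hcD
    have h₂ := hcost D (hT.cost.trans hcD)
    rw [List.length_cons, add_mul, one_mul]
    simp only [Run.wait] at h₁ ⊢
    omega
  · intro D b hcD hb hs
    have h₂ := hcost D (hT.cost.trans hcD)
    refine HasDelay.wait (hB.delay D b hcD hb ?_) 1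
    have h₃ := hs.output (c := c.time + (I.length + m)) (by omega) c.val.2.2
      (I.toFinset, closedCols P I.toFinset)
    rw [← add_assoc] at h₃
    exact h₃.mono (by omega)

end Recursion

section Main

variable {n m : ℕ} {P : Input n m}

/-! ### Maximal biclusters -/

theorem isMaximalCVC_iff (hε : 0 ≤ P.ε) {B : Bicluster n m} :
    IsMaximalCVC P.A P.ε B ↔ B.2 = closedCols P B.1 ∧ RowMaximal P B.1 B.2 := by
  simp only [IsMaximalCVC, IsCVC, spread_le_iff hε, RowMaximal]
  push Not
  constructor
  · rintro ⟨h₁, h₂, h₃⟩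
    refine ⟨?_, h₂⟩
    ext k
    rw [mem_closedCols]
    refine ⟨h₁ k, fun hk => ?_⟩
    by_contra hkB
    obtain ⟨k', hk', hw⟩ := h₃ k hkB
    rcases Finset.mem_insert.1 hk' with rfl | hk'
    · exact hw hk
    · exact hw (h₁ k' hk')
  · rintro ⟨h₁, h₂⟩
    have h₃ : ∀ k, k ∈ B.2 ↔ Within P.A P.ε B.1 k := fun k => by rw [h₁, mem_closedCols]
    exact ⟨fun k hk => (h₃ k).1 hk, h₂, fun y hy => ⟨y, by simp, fun h => hy ((h₃ y).2 h)⟩⟩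

/-- A family of row-sets that contains `X` and, with each row-set, its descendants contains all
row-maximal row-sets. -/
theorem mem_of_expanded {F : Set (Finset (Fin n))} (huniv : Finset.univ ∈ F)
    (hF : ∀ I ∈ F, ∀ k : Fin m, RowMaximal P I (closedBelow P I k.val) →
      ¬ Within P.A P.ε I k → ∀ M, IsDescendant P I k M → M ∈ F) :
    ∀ (k : ℕ) (M : Finset (Fin n)), P.minRow ≤ M.card → RowMaximal P M (closedBelow P M k) →
      M ∈ F := by
  intro k
  induction k with
  | zero =>
    intro M _ hM
    have : M = Finset.univ := by
      ext x
      simp only [Finset.mem_univ, iff_true]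
      by_contra hx
      obtain ⟨k, hk, -⟩ := hM x hx
      simp at hk
    exact this ▸ huniv
  | succ k ih =>
    intro M hc hM
    by_cases hk : ∃ h : k < m, Within P.A P.ε M ⟨k, h⟩
    · obtain ⟨hkm, hMk⟩ := hk
      -- The parent of `M`: inclusion-maximal among the row-sets containing `M` on which the closed
      -- columns of `M` below `k` stay closed. It therefore has the same closed columns below `k`
      -- and is row-maximal for them.
      obtain ⟨I, hMI, hI⟩ := (Set.toFinite {I : Finset (Fin n) | M ⊆ I ∧
        ∀ k' ∈ closedBelow P M k, Within P.A P.ε I k'}).exists_le_maximal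
        (a := M) ⟨subset_rfl, fun k' hk' => (mem_closedBelow.1 hk').1⟩
      have hcl : closedBelow P I k = closedBelow P M k := by
        ext k'
        constructor
        · intro h
          rw [mem_closedBelow] at h ⊢
          exact ⟨h.1.mono hMI, h.2⟩
        · intro h
          rw [mem_closedBelow]
          exact ⟨hI.prop.2 k' h, (mem_closedBelow.1 h).2⟩
      have hImax : RowMaximal P I (closedBelow P I k) := by
        intro x hx
        by_contra! h
        rw [hcl] at h
        have := hI.le_of_ge (y := insert x I)
          ⟨hMI.trans (Finset.subset_insert x I), h⟩ (Finset.subset_insert x I)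
        exact hx (this (Finset.mem_insert_self x I))
      have hIF : I ∈ F := ih I (hc.trans (Finset.card_le_card hMI)) hImax
      -- The rows of `I` fit `M` on all its closed columns below `k`, so only column `k` can refuse
      -- those outside `M`; hence `M` is a maximal run of `I` in column `k`.
      have hadd : ∀ x ∈ I, x ∉ M → ¬ Within P.A P.ε (insert x M) ⟨k, hkm⟩ := by
        intro x hxI hxM
        obtain ⟨k', hk', hw⟩ := hM x hxM
        rw [mem_closedBelow] at hk'
        have : ¬ k'.val < k := fun hlt => hw
          ((hI.prop.2 k' (mem_closedBelow.2 ⟨hk'.1, hlt⟩)).mono (Finset.insert_subset hxI hMI))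
        have : k' = ⟨k, hkm⟩ := Fin.ext (by simp only; omega)
        exact this ▸ hw
      by_cases hIk : Within P.A P.ε I ⟨k, hkm⟩
      · have : I = M := Finset.Subset.antisymm (fun x hx => by
          by_contra hxM
          exact hadd x hx hxM (hIk.mono (Finset.insert_subset hx hMI))) hMI
        exact this ▸ hIF
      · refine hF I hIF ⟨k, hkm⟩ hImax hIk M ⟨⟨hMI, hMk, hadd⟩, hc, ?_, hM⟩
        intro k' hk' hMk'
        exact hI.prop.2 k' (mem_closedBelow.2 ⟨hMk', hk'⟩)
    · refine ih M hc (hM.mono fun k' hk' => ?_)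
      rw [mem_closedBelow] at hk' ⊢
      refine ⟨hk'.1, lt_of_le_of_ne (Nat.lt_succ_iff.1 hk'.2) fun e => hk ⟨e ▸ k'.isLt, ?_⟩⟩
      subst e
      exact hk'.1

/-! ### The whole run -/

theorem frame_root (hrn : P.minRow ≤ n) : Frame P (List.finRange n) [] 0 where
  sorted := List.pairwise_lt_finRange n
  minRow_le := by simpa using hrn
  rowMaximal x hx := by simp at hx
  least _ _ := Nat.zero_le _
  nodup := List.nodup_nil
  disjoint := by simp
  cover _ _ _ x hx := by simp at hx

variable {σ : Type} {S : SymbolTable (List (Fin n)) σ} (T : TableSpec S)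

theorem rinCloseCVC_spec (hε : 0 ≤ P.ε) (hr : 1 ≤ P.minRow) (hrn : P.minRow ≤ n) :
    Complete P.A P.ε P.minRow (rinCloseCVC P S).biclusters ∧
    Correct P.A P.ε P.minRow (rinCloseCVC P S).biclusters ∧
    NonRedundant P.A P.ε (rinCloseCVC P S).biclusters ∧
    1 ≤ (rinCloseCVC P S).out.length ∧ (rinCloseCVC P S).out.length ≤ 2 ^ n ∧
    (∃ K, T.Rep (rinCloseCVC P S).table K ∧ K.card ≤ (rinCloseCVC P S).out.length) ∧
    ∀ D, T.cost (rinCloseCVC P S).table ≤ D →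
      (rinCloseCVC P S).clock ≤ n + m + S.empty.time +
        (rinCloseCVC P S).out.length * nodeCost n m D ∧
      (S.empty.time = 0 → ∀ b, nodeCost n m D + (n + 2 * m + 1) ≤ b →
        List.IsChain (fun s t => s ≤ t ∧ t ≤ s + b)
          (0 :: (rinCloseCVC P S).out.map Prod.fst ++ [(rinCloseCVC P S).clock])) := by
  obtain ⟨rows, K, hT, hB⟩ := computeBiclustersFrom_spec T hε hr m 0 rfl
    (s := ⟨n + m + S.empty.time, S.empty.val, []⟩) (frame_root hrn)
    (J := ∅) ⟨by simp, by simp⟩ T.rep_empty (Or.inr (by simp))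
  change Traversal T 0 _ _ _ rows (rinCloseCVC P S) K at hT
  change TimeBounds T _ rows.length (rinCloseCVC P S) _ _ _ at hB
  have hb : (rinCloseCVC P S).biclusters =
      rows.map fun G => (G.toFinset, closedCols P G.toFinset) := hT.biclusters
  have hlen : (rinCloseCVC P S).out.length = rows.length := by
    have := congrArg List.length hb
    simpa [Run.biclusters] using this
  have hsorted : ∀ G ∈ rows, G.Pairwise (· < ·) := fun G hG => by
    obtain ⟨Γ, y, -, hF, -⟩ := hT.expanded G hG
    exact hF.sorted
  have hinj : (rows.map List.toFinset).Nodup := by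
    refine List.Nodup.map_on (fun G hG G' hG' e => ?_) hT.nodup
    have hp : G.Perm G' := List.perm_of_nodup_nodup_toFinset_eq
      ((hsorted G hG).imp ne_of_lt) ((hsorted G' hG').imp ne_of_lt) e
    -- Keys are ascending lists, so distinct keys are distinct row-sets; this gives both
    -- non-redundancy and `q ≤ 2 ^ n`.
    exact hp.eq_of_pairwise (fun _ _ _ _ h h' => absurd h (lt_asymm h')) (hsorted G hG)
      (hsorted G' hG')
  have hmem : ∀ G, G ∈ rows ↔ G = List.finRange n ∨ G ∈ K := fun G => by
    rw [hT.mem_iff]; simp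
  have hmaximal : ∀ B ∈ (rinCloseCVC P S).biclusters,
      IsMaximalCVC P.A P.ε B ∧ P.minRow ≤ B.1.card := by
    intro B hB'
    rw [hb] at hB'
    obtain ⟨G, hG, rfl⟩ := List.mem_map.1 hB'
    obtain ⟨Γ, y, -, hF, -⟩ := hT.expanded G hG
    refine ⟨(isMaximalCVC_iff hε).2 ⟨rfl, hF.rowMaximal⟩, ?_⟩
    rw [List.toFinset_card_of_nodup (hF.sorted.imp ne_of_lt)]
    exact hF.minRow_le
  refine ⟨?_, fun B hB' => ⟨(hmaximal B hB').1.1, (hmaximal B hB').2⟩,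
    ⟨fun B hB' => (hmaximal B hB').1, ?_⟩, ?_, ?_, ⟨K, hT.rep, ?_⟩, ?_⟩
  · intro B hB' hc
    obtain ⟨h₁, h₂⟩ := (isMaximalCVC_iff hε).1 hB'
    have hBF := mem_of_expanded (P := P) (F := {M | ∃ G ∈ rows, G.toFinset = M})
      ⟨List.finRange n, (hmem _).2 (Or.inl rfl), by simp⟩ (by
        rintro _ ⟨G, hG, rfl⟩ k hk hw M hM
        obtain ⟨Γ, y, -, hF, hD⟩ := hT.expanded G hG
        obtain ⟨G', hG', e⟩ := hD k M (hF.least _ hk) hw hM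
        exact ⟨G', (hmem G').2 (Or.inr hG'), e⟩) m B.1 hc (h₂.mono fun k hk => by
          rw [h₁, mem_closedCols] at hk
          exact mem_closedBelow.2 ⟨hk, k.isLt⟩)
    obtain ⟨G, hG, e⟩ := hBF
    rw [hb]
    refine List.mem_map.2 ⟨G, hG, ?_⟩
    rw [e, ← h₁]
  · rw [hb]
    refine List.Nodup.of_map Prod.fst ?_
    rw [List.map_map]
    exact hinj
  · rw [hlen]
    exact List.length_pos_of_mem ((hmem _).2 (Or.inl rfl))
  · rw [hlen, ← List.length_map (f := List.toFinset) (as := rows)]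
    simpa using hinj.length_le_card
  · rw [hlen, ← List.toFinset_card_of_nodup hT.nodup]
    exact Finset.card_le_card fun G hG => by simpa using (hmem G).2 (Or.inr hG)
  · intro D hD
    refine ⟨?_, fun h0 b hb' => ?_⟩
    · have := hB.total D hD
      rw [hlen]
      simp only at this
      omega
    · have h₁ := hB.delay D b hD hb' ⟨[], 0, by simp, by simp, by simp, by simp only; omega⟩
      obtain ⟨a, l, h₂, h₃⟩ := h₁.isChain (t := (rinCloseCVC P S).clock) le_rfl (by omega)
      rw [h₂]
      exact h₃

/-! ### Numerical estimates -/

theorem nodeCost_le {D z : ℕ} (hn : 1 ≤ n) (hm : 1 ≤ m) (hD : D ≤ 19 * (n * (z + 1))) :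
    nodeCost n m D ≤ 72 * (n * m * (n * m + n * z)) := by
  have h₁ : n * D ≤ n * (19 * (n * (z + 1))) := Nat.mul_le_mul_left n hD
  have h₂ : m * (27 * (n ^ 2 * m) + 2 * (n * D)) ≤
      m * (27 * (n ^ 2 * m) + 2 * (n * (19 * (n * (z + 1))))) := by gcongr
  have e : m * (27 * (n ^ 2 * m) + 2 * (n * (19 * (n * (z + 1))))) =
      27 * (n * m * (n * m)) + 38 * (n * m * (n * z)) + 38 * (n * (n * m)) := by ring
  have h₃ : n ≤ n * m := Nat.le_mul_of_pos_right n hm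
  have h₄ : m ≤ n * m := Nat.le_mul_of_pos_left m hn
  have h₅ : n * (n * m) ≤ n * m * (n * m) := Nat.mul_le_mul_right _ h₃
  have h₆ : n * m ≤ n * m * (n * m) := Nat.le_mul_self _
  rw [mul_add]
  unfold nodeCost
  omega

end Main

/-- Here `z` is `log q` for the tree and the chain length for the hash table. The term `n * log n`
is slack: `n * m` already absorbs the sorting. -/
theorem total_time_le {n m q b D z c : ℕ} (hn : 1 ≤ n) (hm : 1 ≤ m) (hq : 1 ≤ q)
    (hD : D ≤ 19 * (n * (z + 1))) (hc : c ≤ n + m + b + q * nodeCost n m D) :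
    c ≤ 150 * (b + q * n * m * (n * Nat.log 2 n + n * m + n * z)) := by
  have h₁ := Nat.mul_le_mul_left q (nodeCost_le hn hm hD)
  have h₃ : n ≤ n * m := Nat.le_mul_of_pos_right n hm
  have h₄ : m ≤ n * m := Nat.le_mul_of_pos_left m hn
  have h₆ : n * m ≤ n * m * (n * m) := Nat.le_mul_self _
  have h₇ : n * m * (n * m) ≤ q * (n * m * (n * m)) := Nat.le_mul_of_pos_left _ hq
  have e₁ : q * (72 * (n * m * (n * m + n * z))) =
      72 * (q * (n * m * (n * m))) + 72 * (q * n * m * (n * z)) := by ring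
  have e₂ : q * n * m * (n * Nat.log 2 n + n * m + n * z) =
      q * n * m * (n * Nat.log 2 n) + q * (n * m * (n * m)) + q * n * m * (n * z) := by ring
  rw [e₂]
  omega

/-- Since `t.size + 1 ≤ 2 * q`, the logarithm grows by at most one; then `9 * n * log q + 18 * n +
1` fits under the common constant 19. -/
theorem searchTreeSpec_cost_le {n q : ℕ} {t : Ordnode (List (Fin n))} (hn : 1 ≤ n) (hq : 1 ≤ q)
    (ht : t.size ≤ q) : (searchTreeSpec n).cost t ≤ 19 * (n * (Nat.log 2 q + 1)) := by
  have h₁ : Nat.log 2 (t.size + 1) ≤ Nat.log 2 q + 1 := by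
    rw [← Nat.log_mul_base one_lt_two (by omega)]
    exact Nat.log_mono_right (by omega)
  change (3 * Nat.log 2 (t.size + 1) + 3) * (n + 2) + 1 ≤ _
  have h₂ : (3 * Nat.log 2 (t.size + 1) + 3) * (n + 2) ≤ (3 * (Nat.log 2 q + 1) + 3) * (3 * n) :=
    Nat.mul_le_mul (by omega) (by omega)
  have e : (3 * (Nat.log 2 q + 1) + 3) * (3 * n) = 9 * (n * Nat.log 2 q) + 18 * n := by ring
  rw [mul_add n (Nat.log 2 q)]
  omega

theorem hashTableSpec_cost_le {n b L : ℕ} (hash : List (Fin n) → Fin b)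
    {t : Fin b → List (List (Fin n))} (hn : 1 ≤ n) (ht : ∀ i, (t i).length ≤ L) :
    (hashTableSpec hash).cost t ≤ 19 * (n * (L + 1)) := by
  have h₁ : (Finset.univ.sup fun i => (t i).length) ≤ L := Finset.sup_le fun i _ => ht i
  change (Finset.univ.sup fun i => (t i).length) * (n + 2) + (n + 2) ≤ _
  have h₂ : (Finset.univ.sup fun i => (t i).length) * (n + 2) ≤ L * (3 * n) :=
    Nat.mul_le_mul h₁ (by omega)
  have e : L * (3 * n) = 3 * (n * L) := by ring
  rw [mul_add n L]
  omega

theorem delay_le {n m D : ℕ} (hn : 1 ≤ n) (hm : 1 ≤ m) (hD : D ≤ 19 * (n * (n + 1))) :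
    nodeCost n m D + (n + 2 * m + 1) ≤ 150 * (n ^ 2 * m * (n + m)) := by
  have h₁ := nodeCost_le hn hm hD
  have h₃ : n ≤ n * m := Nat.le_mul_of_pos_right n hm
  have h₄ : m ≤ n * m := Nat.le_mul_of_pos_left m hn
  have h₆ : n * m ≤ n * m * (n * m) := Nat.le_mul_self _
  have e₁ : n * m * (n * m + n * n) = n ^ 2 * m * (n + m) := by ring
  have e₂ : n ^ 2 * m * (n + m) = n * m * (n * m) + n * m * (n * n) := by ring
  rw [e₁] at h₁
  omega

end RInClose

theorem mainTheorem2 :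
    ∃ C : ℕ, ∀ (n m : ℕ) (A : Matrix (Fin n) (Fin m) ℝ) (ε : ℝ) (minRow : ℕ)
      (rule : RInClose.PivotRule), 0 ≤ ε → 1 ≤ minRow → minRow ≤ n →
      -- the symbol table is a balanced search tree
      (∀ r, r = RInClose.rinCloseCVC ⟨A, ε, minRow, rule⟩ (RInClose.searchTree n) →
        RInClose.Complete A ε minRow r.biclusters ∧
        RInClose.Correct A ε minRow r.biclusters ∧
        RInClose.NonRedundant A ε r.biclusters ∧
        (1 ≤ m →
          -- polynomial time before the first, between consecutive and after the last bicluster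
          List.IsChain (fun s t => s ≤ t ∧ t ≤ s + C * (n ^ 2 * m * (n + m)))
            (0 :: r.out.map Prod.fst ++ [r.clock]) ∧
          -- total running time, linearithmic in the number of biclusters
          r.clock ≤ C * (r.out.length * n * m *
            (n * Nat.log 2 n + n * m + n * Nat.log 2 r.out.length)))) ∧
      -- the symbol table is a hash table with `b` chained buckets
      (∀ (b : ℕ) (hash : List (Fin n) → Fin b),
        ∀ r, r = RInClose.rinCloseCVC ⟨A, ε, minRow, rule⟩ (RInClose.hashTable hash) →
        RInClose.Complete A ε minRow r.biclusters ∧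
        RInClose.Correct A ε minRow r.biclusters ∧
        RInClose.NonRedundant A ε r.biclusters ∧
        (1 ≤ m →
          -- total running time, in terms of the length of the longest chain
          (∀ L : ℕ, (∀ i, (r.table i).length ≤ L) →
            r.clock ≤ C * (b + r.out.length * n * m *
              (n * Nat.log 2 n + n * m + n * L))) ∧
          -- worst case, quadratic in the number of biclusters
          r.clock ≤ C * (b + r.out.length * n * m *
            (n * Nat.log 2 n + n * m + n * r.out.length)))) := by
  -- A generous constant: the estimates of `total_time_le` and `delay_le` already give 76.
  refine ⟨150, fun n m A ε minRow rule hε hr hrn => ?_⟩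
  have hn : 1 ≤ n := hr.trans hrn
  refine ⟨?_, ?_⟩
  · rintro r rfl
    obtain ⟨h₁, h₂, h₃, hq, hq2, ⟨K, hK, hKc⟩, ht⟩ := RInClose.rinCloseCVC_spec
      (P := ⟨A, ε, minRow, rule⟩) (RInClose.searchTreeSpec n) hε hr hrn
    refine ⟨h₁, h₂, h₃, fun hm => ?_⟩
    have hcost := RInClose.searchTreeSpec_cost_le hn hq (hK.2.2.trans hKc)
    obtain ⟨ht₁, ht₂⟩ := ht _ hcost
    refine ⟨ht₂ rfl _ (RInClose.delay_le hn hm ?_), ?_⟩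
    -- There are at most `2 ^ n` outputs, so `log q ≤ n` and the delay bound is free of `q`.
    · have : Nat.log 2 (RInClose.rinCloseCVC ⟨A, ε, minRow, rule⟩
          (RInClose.searchTree n)).out.length ≤ n :=
        (Nat.log_mono_right hq2).trans (Nat.log_pow one_lt_two n).le
      gcongr
    · have := RInClose.total_time_le (b := 0) hn hm hq le_rfl ht₁
      rwa [zero_add] at this
  · rintro b hash r rfl
    obtain ⟨h₁, h₂, h₃, hq, -, ⟨K, hK, hKc⟩, ht⟩ := RInClose.rinCloseCVC_spec
      (P := ⟨A, ε, minRow, rule⟩) (RInClose.hashTableSpec hash) hε hr hrn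
    refine ⟨h₁, h₂, h₃, fun hm => ?_⟩
    have htotal : ∀ L : ℕ, (∀ i, ((RInClose.rinCloseCVC ⟨A, ε, minRow, rule⟩
        (RInClose.hashTable hash)).table i).length ≤ L) → _ := fun L hL =>
      RInClose.total_time_le (b := b) hn hm hq le_rfl
        (ht _ (RInClose.hashTableSpec_cost_le hash hn hL)).1
    -- Every key in the table is the row-set of an output, so no chain is longer than the number of
    -- outputs.
    exact ⟨htotal, htotal _ fun i => (hK.2 i).trans hKc⟩
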